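/- Let $\ell\ge 1$ and $d\ge 0$ be integers. Let $\mathcal G=\mathcal G_{(\ell,d)}$ be the groupoid whose objects are the maps $f:\{1,\dots,d\}\to\{1,\dots,\ell\}$ and whose morphisms $f\to g$ are the bijections $\sigma$ of $\{1,\dots,d\}$ with $g\circ\sigma=f$, composed as maps. The type of $f$ is the composition $\boldsymbol\lambda_f=(|f^{-1}(1)|,\dots,|f^{-1}(\ell)|)$ of $d$ into $\ell$ parts (zero parts allowed). Let $\mathbb C\mathcal G$ be the $\mathbb C$-linearization of $\mathcal G$; a $\mathbb C\mathcal G$-module is a $\mathbb C$-linear functor from $\mathbb C\mathcal G$ to finite dimensional complex vector spaces, and morphisms are natural transformations. For a composition $\boldsymbol\lambda=(\lambda_1,\dots,\lambda_\ell)$ of $d$, let $\mathbf T_{\boldsymbol\lambda}$ be the set of $\ell$-multipartitions of shape $\boldsymbol\lambda$, i.e. of tuples $\mathbf p=(p_1,\dots,p_\ell)$ of partitions $p_i\vdash\lambda_i$, and let $\mathscr S_{\mathbf p}=\mathscr S_{p_1}\otimes\cdots\otimes\mathscr S_{p_\ell}$ be the tensor product of the complex Specht modules, a representation of $S_{\boldsymbol\lambda}=S_{\lambda_1}\times\cdots\times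 S_{\lambda_\ell}$. For $f,g$ of type $\boldsymbol\lambda$ let $\sigma_{f\to g}:f\to g$ be the unique morphism that is increasing on each set $f^{-1}(i)$. Let $f_{\boldsymbol\lambda}$ be the unique weakly increasing map of type $\boldsymbol\lambda$, and identify its automorphism group with $S_{\boldsymbol\lambda}$ by numbering each set $f_{\boldsymbol\lambda}^{-1}(i)$ increasingly. Let $L_{\mathbf p}$ be the $\mathbb C\mathcal G$-module with $L_{\mathbf p}(f)=\mathscr S_{\mathbf p}$ if $f$ is of type $\boldsymbol\lambda$ and $L_{\mathbf p}(f)=0$ otherwise, on which a morphism $\pi:f\to g$ between objects of type $\boldsymbol\lambda$ acts as the element $\sigma_{g\to f_{\boldsymbol\lambda}}\circ\pi\circ\sigma_{f_{\boldsymbol\lambda}\to f}$ of $S_{\boldsymbol\lambda}$. Let $S(\ell,d)=\mathbf C_\ell\wr S_d$ be the group of monomial $d\times d$-matrices whose non-zero entries are complex $\ell$-th roots of unity. For a $\mathbb C\mathcal G$-module $M$ let $\overline\Phi(M)$ be the space $\bigoplus_f M(f)$ on which the matrix $\mathrm{diag}(z_1,\dots,z_d)\cdot\sigma$ with $\sigma\in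 S_d$ sends $v\in M(f\circ\sigma)$ to $\prod_{j=1}^d z_j^{f(j)}\cdot M(\sigma:f\circ\sigma\to f)(v)\in M(f)$, for every object $f$; this is a representation of $S(\ell,d)$. Then: (i) For every composition $\boldsymbol\lambda$ of $d$ into $\ell$ parts and every $\mathbf p\in\mathbf T_{\boldsymbol\lambda}$, the functor $L_{\mathbf p}$ is a simple $\mathbb C\mathcal G$-module. (ii) The modules $L_{\mathbf p}$, where $\boldsymbol\lambda$ runs through all compositions of $d$ into $\ell$ parts and $\mathbf p$ through $\mathbf T_{\boldsymbol\lambda}$, form a complete and irredundant set of representatives of the isomorphism classes of simple $\mathbb C\mathcal G$-modules. (iii) Consequently the representations $\overline\Phi(L_{\mathbf p})$ form a complete and irredundant set of representatives of the isomorphism classes of irreducible complex representations of $\mathbf C_\ell\wr S_d$, which are thus classified by the $\ell$-multipartitions of $d$. -/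

import Mathlib

open CategoryTheory
open scoped TensorProduct

namespace GenSym

noncomputable section

/-! ## Specht modules of symmetric groups -/

/-- The Young diagram of a partition: row `i` has as many cells as the `i`-th largest part. -/
def diagram {n : ℕ} (μ : Nat.Partition n) : YoungDiagram :=
  YoungDiagram.ofRowLens (μ.parts.sort (· ≥ ·)) (μ.parts.pairwise_sort (· ≥ ·)).sortedGE

/-- A Young tableau of shape `μ ⊢ n`: a bijective filling of the cells of the diagram of `μ`. -/
abbrev Tableau {n : ℕ} (μ : Nat.Partition n) : Type :=
  {c : ℕ × ℕ // c ∈ (diagram μ).cells} ≃ Fin n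

/-- The row containing a given entry. -/
def Tableau.row {n : ℕ} {μ : Nat.Partition n} (t : Tableau μ) : Fin n → ℕ :=
  fun x => (t.symm x).1.1

/-- The column containing a given entry. -/
def Tableau.col {n : ℕ} {μ : Nat.Partition n} (t : Tableau μ) : Fin n → ℕ :=
  fun x => (t.symm x).1.2

/-- A tabloid is a tableau up to reordering the entries inside each row, that is, a tableau of
which one only remembers the row of each entry. -/
def Tabloid {n : ℕ} (μ : Nat.Partition n) : Type :=
  {r : Fin n → ℕ // ∃ t : Tableau μ, t.row = r}

/-- The tabloid `{t}` of a tableau `t`. -/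
def Tableau.tabloid {n : ℕ} {μ : Nat.Partition n} (t : Tableau μ) : Tabloid μ :=
  ⟨t.row, t, rfl⟩

/-- `S_n` acts on tabloids by permuting the entries: `x` lies in row `i` of `r` if and only if
`σ x` lies in row `i` of `σ • r`. -/
instance {n : ℕ} (μ : Nat.Partition n) : MulAction (Equiv.Perm (Fin n)) (Tabloid μ) where
  smul σ r := ⟨fun x => r.1 (σ⁻¹ x), by
    obtain ⟨t, ht⟩ := r.2
    refine ⟨t.trans σ, ?_⟩
    rw [← ht]
    rfl⟩
  one_smul r := rfl
  mul_smul σ τ r := by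
    apply Subtype.ext
    funext x
    change r.1 ((σ * τ)⁻¹ x) = r.1 (τ⁻¹ (σ⁻¹ x))
    rw [mul_inv_rev]
    rfl

theorem smul_tabloid {n : ℕ} {μ : Nat.Partition n} (σ : Equiv.Perm (Fin n)) (t : Tableau μ) :
    σ • t.tabloid = Tableau.tabloid (t.trans σ) := rfl

/-- The permutation module on the vector space with basis the tabloids of shape `μ`. -/
def tabloidRep {n : ℕ} (μ : Nat.Partition n) :
    Representation ℂ (Equiv.Perm (Fin n)) (Tabloid μ →₀ ℂ) where
  toFun σ := Finsupp.lmapDomain ℂ ℂ (σ • ·)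
  map_one' := by
    ext r
    simp
  map_mul' σ τ := by
    ext r
    simp [mul_smul]

/-- The column stabilizer of a tableau. -/
def Tableau.colStab {n : ℕ} {μ : Nat.Partition n} (t : Tableau μ) :
    Subgroup (Equiv.Perm (Fin n)) where
  carrier := {π | ∀ x, t.col (π x) = t.col x}
  mul_mem' {a b} ha hb x := (ha (b x)).trans (hb x)
  one_mem' _ := rfl
  inv_mem' {a} ha x := by
    have h := ha (a⁻¹ x)
    rw [← Equiv.Perm.mul_apply, mul_inv_cancel] at h
    exact h.symm

open Classical in
/-- The polytabloid `e_t = ∑_{π ∈ C_t} sgn(π) π{t}`. -/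
def Tableau.polytabloid {n : ℕ} {μ : Nat.Partition n} (t : Tableau μ) : Tabloid μ →₀ ℂ :=
  ∑ π : Equiv.Perm (Fin n),
    if π ∈ t.colStab then
      Finsupp.single (π • t.tabloid) ((Equiv.Perm.sign π : ℤ) : ℂ)
    else 0

theorem tabloidRep_polytabloid {n : ℕ} {μ : Nat.Partition n} (σ : Equiv.Perm (Fin n))
    (t : Tableau μ) :
    tabloidRep μ σ t.polytabloid = Tableau.polytabloid (t.trans σ) := by
  classical
  unfold Tableau.polytabloid
  rw [map_sum]
  refine Fintype.sum_equiv (MulAut.conj σ).toEquiv _ _ fun π => ?_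
  have hmem : (MulAut.conj σ).toEquiv π ∈ Tableau.colStab (t.trans σ) ↔ π ∈ t.colStab := by
    constructor
    · intro h x
      have := h (σ x)
      simpa [Tableau.col] using this
    · intro h x
      have := h (σ⁻¹ x)
      simpa [Tableau.col] using this
  by_cases h : π ∈ t.colStab
  · rw [if_pos h, if_pos (hmem.2 h)]
    simp only [tabloidRep, MonoidHom.coe_mk, OneHom.coe_mk, Finsupp.lmapDomain_apply,
      Finsupp.mapDomain_single]
    have hs : Equiv.Perm.sign ((MulAut.conj σ).toEquiv π) = Equiv.Perm.sign π := by
      change Equiv.Perm.sign (σ * π * σ⁻¹) = Equiv.Perm.sign π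
      rw [map_mul, map_mul, Equiv.Perm.sign_inv, mul_right_comm, Int.units_mul_self, one_mul]
    rw [hs, ← smul_tabloid, ← mul_smul, ← mul_smul]
    have hm : (MulAut.conj σ).toEquiv π * σ = σ * π := by simp
    rw [hm]
  · rw [if_neg h, if_neg (fun h' => h (hmem.1 h')), map_zero]

/-- The Specht module: the span of all polytabloids of shape `μ`. -/
def spechtSubmodule {n : ℕ} (μ : Nat.Partition n) : Submodule ℂ (Tabloid μ →₀ ℂ) :=
  Submodule.span ℂ (Set.range (Tableau.polytabloid (μ := μ)))

/-- The Specht module as a vector space. -/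
def Specht {n : ℕ} (μ : Nat.Partition n) : Type := spechtSubmodule μ

instance {n : ℕ} (μ : Nat.Partition n) : AddCommGroup (Specht μ) :=
  inferInstanceAs (AddCommGroup (spechtSubmodule μ))

instance {n : ℕ} (μ : Nat.Partition n) : Module ℂ (Specht μ) :=
  inferInstanceAs (Module ℂ (spechtSubmodule μ))

instance {n : ℕ} (μ : Nat.Partition n) : Module.Finite ℂ (Specht μ) :=
  show Module.Finite ℂ (spechtSubmodule μ) from
    Module.Finite.iff_fg.2 (Submodule.fg_span (Set.finite_range _))

/-- The Specht module as a representation of the symmetric group. -/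
def spechtRep {n : ℕ} (μ : Nat.Partition n) :
    Representation ℂ (Equiv.Perm (Fin n)) (Specht μ) :=
  (tabloidRep μ).subrepresentation (spechtSubmodule μ) fun σ => by
    rw [spechtSubmodule, Submodule.span_le]
    rintro _ ⟨t, rfl⟩
    rw [SetLike.mem_coe, Submodule.mem_comap, tabloidRep_polytabloid]
    exact Submodule.subset_span ⟨_, rfl⟩

/-- The outer tensor product `𝒮_{p_1} ⊗ ⋯ ⊗ 𝒮_{p_ℓ}` as a vector space. -/
abbrev MultiSpecht {ℓ : ℕ} {a : Fin ℓ → ℕ} (p : ∀ i, Nat.Partition (a i)) : Type :=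
  ⨂[ℂ] i, Specht (p i)

/-- The outer tensor product `𝒮_{p_1} ⊗ ⋯ ⊗ 𝒮_{p_ℓ}` as a representation of
`S_{a_1} × ⋯ × S_{a_ℓ}`. -/
def multiSpechtRep {ℓ : ℕ} {a : Fin ℓ → ℕ} (p : ∀ i, Nat.Partition (a i)) :
    Representation ℂ (∀ i, Equiv.Perm (Fin (a i))) (MultiSpecht p) where
  toFun σ := PiTensorProduct.map fun i => spechtRep (p i) (σ i)
  map_one' := by
    simp only [Pi.one_apply, map_one]
    exact PiTensorProduct.map_one
  map_mul' σ τ := by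
    simp only [Pi.mul_apply, map_mul]
    exact PiTensorProduct.map_mul _ _

/-! ## The groupoid of colorings -/

/-- The objects of the groupoid `𝒢_{(ℓ,d)}`: colorings of `d` points by `ℓ` colors. (Points and
colors are numbered from `0`.) -/
structure Coloring (ℓ d : ℕ) where
  /-- The color of each point. -/
  color : Fin d → Fin ℓ

instance (ℓ d : ℕ) : CoeFun (Coloring ℓ d) (fun _ => Fin d → Fin ℓ) := ⟨Coloring.color⟩

/-- Morphisms `f ⟶ g` are the bijections `σ` with `g ∘ σ = f`, composed as maps. -/
instance (ℓ d : ℕ) : Groupoid (Coloring ℓ d) where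
  Hom f g := {σ : Equiv.Perm (Fin d) // ∀ x, g (σ x) = f x}
  id f := ⟨1, fun _ => rfl⟩
  comp σ τ := ⟨τ.1 * σ.1, fun x => (τ.2 (σ.1 x)).trans (σ.2 x)⟩
  inv {f g} σ := ⟨σ.1⁻¹, fun x => by
    have h := σ.2 (σ.1⁻¹ x)
    rw [← Equiv.Perm.mul_apply, mul_inv_cancel] at h
    exact h.symm⟩
  inv_comp σ := Subtype.ext (mul_inv_cancel σ.1)
  comp_inv σ := Subtype.ext (inv_mul_cancel σ.1)

/-- Compositions of `d` with `ℓ` parts, zero parts being allowed. -/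
def Comp (ℓ d : ℕ) : Type := {a : Fin ℓ → ℕ // ∑ i, a i = d}

/-- The type of a coloring: the numbers of points of each color. -/
def type {ℓ d : ℕ} (f : Coloring ℓ d) : Comp ℓ d :=
  ⟨fun i => Fintype.card {x // f x = i}, by
    rw [← Fintype.card_sigma, Fintype.card_congr (Equiv.sigmaFiberEquiv f), Fintype.card_fin]⟩

/-- A morphism restricts to a bijection between the sets of points of color `i`. -/
def fibreMap {ℓ d : ℕ} {f g : Coloring ℓ d} (π : f ⟶ g) (i : Fin ℓ) :
    {x // f x = i} ≃ {x // g x = i} :=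
  π.1.subtypeEquiv fun x => by rw [π.2 x]

/-- The increasing enumeration of the points of color `i`. -/
def fibreIso {ℓ d : ℕ} {f : Coloring ℓ d} {a : Comp ℓ d} (h : type f = a) (i : Fin ℓ) :
    Fin (a.1 i) ≃o {x // f x = i} :=
  Fintype.orderIsoFinOfCardEq _ (congrFun (congrArg Subtype.val h) i)

/-- The order preserving morphism `σ_{(f,g)}` between two colorings of the same type: on the
points of each color it is the increasing bijection. -/
def ordIso {ℓ d : ℕ} {a : Comp ℓ d} {f g : Coloring ℓ d} (hf : type f = a) (hg : type g = a) :
    f ⟶ g :=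
  ⟨(Equiv.sigmaFiberEquiv f).symm.trans
      ((Equiv.sigmaCongrRight fun i =>
        (fibreIso hf i).symm.toEquiv.trans (fibreIso hg i).toEquiv).trans
      (Equiv.sigmaFiberEquiv g)),
    fun x => (fibreIso hg (f x) ((fibreIso hf (f x)).symm ⟨x, rfl⟩)).2⟩

theorem ordIso_apply {ℓ d : ℕ} {a : Comp ℓ d} {f g : Coloring ℓ d} (hf : type f = a)
    (hg : type g = a) {i : Fin ℓ} (x : {x // f x = i}) :
    (ordIso hf hg).1 x.1 = (fibreIso hg i ((fibreIso hf i).symm x)).1 := by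
  obtain ⟨x, rfl⟩ := x
  rfl

/-- `σ_{(f,g)}` preserves the order of points of the same color. -/
theorem ordIso_lt {ℓ d : ℕ} {a : Comp ℓ d} {f g : Coloring ℓ d} (hf : type f = a)
    (hg : type g = a) {x y : Fin d} (hxy : x < y) (hc : f x = f y) :
    (ordIso hf hg).1 x < (ordIso hf hg).1 y := by
  rw [ordIso_apply hf hg (i := f y) ⟨x, hc⟩, ordIso_apply hf hg (i := f y) ⟨y, rfl⟩]
  exact (fibreIso hg _).strictMono ((fibreIso hf _).symm.strictMono hxy)

theorem ordIso_trans {ℓ d : ℕ} {a : Comp ℓ d} {f g h : Coloring ℓ d} (hf : type f = a)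
    (hg : type g = a) (hh : type h = a) : ordIso hf hg ≫ ordIso hg hh = ordIso hf hh := by
  apply Subtype.ext
  ext1 x
  change (ordIso hg hh).1 ((ordIso hf hg).1 x) = (ordIso hf hh).1 x
  rw [ordIso_apply hf hg (i := f x) ⟨x, rfl⟩, ordIso_apply, ordIso_apply hf hh (i := f x) ⟨x, rfl⟩]
  simp

theorem ordIso_refl {ℓ d : ℕ} {a : Comp ℓ d} {f : Coloring ℓ d} (hf : type f = a) :
    ordIso hf hf = 𝟙 f := by
  apply Subtype.ext
  ext1 x
  rw [ordIso_apply hf hf (i := f x) ⟨x, rfl⟩]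
  simp
  rfl

/-- The canonical coloring `f_a` of type `a`: the first `a_1` points have the first color, the next
`a_2` points the second color, and so on. -/
def canon {ℓ d : ℕ} (a : Comp ℓ d) : Coloring ℓ d :=
  ⟨fun x => (finSigmaFinEquiv.symm (Fin.cast a.2.symm x)).1⟩

theorem type_canon {ℓ d : ℕ} (a : Comp ℓ d) : type (canon a) = a := by
  apply Subtype.ext
  funext i
  have e : {x // canon a x = i} ≃ {y : (i : Fin ℓ) × Fin (a.1 i) // y.1 = i} :=
    ((finCongr a.2.symm).trans finSigmaFinEquiv.symm).subtypeEquiv fun x => Iff.rfl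
  change Fintype.card {x // canon a x = i} = a.1 i
  rw [Fintype.card_congr (e.trans (Equiv.sigmaSubtype i)), Fintype.card_fin]

/-- The identification of the automorphism group of `f_a` with `S_{a_1} × ⋯ × S_{a_ℓ}`, obtained by
numbering the points of each color increasingly. -/
def autToYoung {ℓ d : ℕ} {a : Comp ℓ d} (π : canon a ⟶ canon a) (i : Fin ℓ) :
    Equiv.Perm (Fin (a.1 i)) :=
  ((fibreIso (type_canon a) i).toEquiv.trans (fibreMap π i)).trans
    (fibreIso (type_canon a) i).symm.toEquiv

theorem autToYoung_id {ℓ d : ℕ} (a : Comp ℓ d) : autToYoung (𝟙 (canon a)) = 1 := by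
  funext i
  ext1 x
  exact (fibreIso (type_canon a) i).symm_apply_apply x

theorem autToYoung_comp {ℓ d : ℕ} {a : Comp ℓ d} (π ρ : canon a ⟶ canon a) :
    autToYoung (π ≫ ρ) = autToYoung ρ * autToYoung π := by
  funext i
  ext1 x
  change (fibreIso (type_canon a) i).symm
      (fibreMap ρ i (fibreMap π i (fibreIso (type_canon a) i x))) =
    (fibreIso (type_canon a) i).symm (fibreMap ρ i (fibreIso (type_canon a) i
      ((fibreIso (type_canon a) i).symm (fibreMap π i (fibreIso (type_canon a) i x)))))
  rw [OrderIso.apply_symm_apply]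

/-! ## Modules over the linearized groupoid -/

/-- The category of `ℂ𝒢_{(ℓ,d)}`-modules: `ℂ`-linear functors from the linearization of the
groupoid to finite dimensional complex vector spaces. -/
abbrev GMod (ℓ d : ℕ) :=
  ObjectProperty.FullSubcategory
    (fun F : Free ℂ (Coloring ℓ d) ⥤ FGModuleCat.{0} ℂ => F.Additive ∧ F.Linear ℂ)

/-- The value of a module at an object. -/
abbrev GMod.val {ℓ d : ℕ} (M : GMod ℓ d) (f : Coloring ℓ d) : Type :=
  M.obj.obj (Free.of ℂ f)

/-- The action of a groupoid morphism on a module. -/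
abbrev GMod.act {ℓ d : ℕ} (M : GMod ℓ d) {f g : Coloring ℓ d} (π : f ⟶ g) :
    M.val f →ₗ[ℂ] M.val g :=
  (M.obj.map ((Free.embedding ℂ (Coloring ℓ d)).map π)).hom.hom

/-- The linear extension to `ℂ`-linear combinations of morphisms `f ⟶ g` of the action of a functor
on morphisms. -/
def linMap {ℓ d : ℕ} (F : Coloring ℓ d ⥤ FGModuleCat.{0} ℂ) (f g : Coloring ℓ d) :
    (Free.of ℂ f ⟶ Free.of ℂ g) →ₗ[ℂ] (F.obj f ⟶ F.obj g) :=
  Finsupp.linearCombination ℂ fun π : f ⟶ g => F.map π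

theorem linMap_single {ℓ d : ℕ} (F : Coloring ℓ d ⥤ FGModuleCat.{0} ℂ) {f g : Coloring ℓ d}
    (π : f ⟶ g) (r : ℂ) : linMap F f g (Finsupp.single π r) = r • F.map π :=
  Finsupp.linearCombination_single ℂ r π

theorem linMap_comp {ℓ d : ℕ} (F : Coloring ℓ d ⥤ FGModuleCat.{0} ℂ) {f g h : Coloring ℓ d}
    (u : Free.of ℂ f ⟶ Free.of ℂ g) (v : Free.of ℂ g ⟶ Free.of ℂ h) :
    linMap F f h (u ≫ v) = linMap F f g u ≫ linMap F g h v := by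
  let B : ((f ⟶ g) →₀ ℂ) →ₗ[ℂ] ((g ⟶ h) →₀ ℂ) →ₗ[ℂ] (F.obj f ⟶ F.obj h) :=
    (Linear.comp (Free.of ℂ f) (Free.of ℂ g) (Free.of ℂ h)).compr₂ (linMap F f h)
  let B' : ((f ⟶ g) →₀ ℂ) →ₗ[ℂ] ((g ⟶ h) →₀ ℂ) →ₗ[ℂ] (F.obj f ⟶ F.obj h) :=
    (Linear.comp (F.obj f) (F.obj g) (F.obj h)).compl₁₂ (linMap F f g) (linMap F g h)
  have key : B = B' := by
    refine Finsupp.lhom_ext fun π r => Finsupp.lhom_ext fun ρ s => ?_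
    refine (congrArg (linMap F f h) (Free.single_comp_single ℂ _ π ρ r s)).trans ?_
    refine (linMap_single F (π ≫ ρ) (r * s)).trans ?_
    refine Eq.trans ?_ (congrArg₂ (· ≫ ·) (linMap_single F π r) (linMap_single F ρ s)).symm
    simp only [F.map_comp, Linear.smul_comp, Linear.comp_smul, smul_smul, mul_comm r s]
  exact LinearMap.congr_fun (LinearMap.congr_fun key u) v

/-- The `ℂ𝒢_{(ℓ,d)}`-module obtained by extending a functor on the groupoid linearly. -/
def linExt {ℓ d : ℕ} (F : Coloring ℓ d ⥤ FGModuleCat.{0} ℂ) : GMod ℓ d where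
  obj :=
    { obj := fun f => F.obj f
      map := fun {f g} u => linMap F f g u
      map_id := fun f => (linMap_single F (𝟙 (show Coloring ℓ d from f)) 1).trans
        ((one_smul ℂ _).trans (F.map_id (show Coloring ℓ d from f)))
      map_comp := fun u v => linMap_comp F u v }
  property := ⟨⟨fun {f g} {u v} => map_add (linMap F f g) u v⟩,
    ⟨fun {f g} u r => map_smul (linMap F f g) r u⟩⟩

/-! ## The modules `L_p` -/

/-- The `ℓ`-multi-partitions of `d`: a composition `a` of `d` with `ℓ` parts (the shape) together
with a partition of each of its parts. -/
def MultiPartition (ℓ d : ℕ) : Type := (a : Comp ℓ d) × (∀ i, Nat.Partition (a.1 i))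

/-- The element `σ_{(g,f_a)} π σ_{(f_a,f)}` of `S_{a_1} × ⋯ × S_{a_ℓ}` attached to a morphism
`π : f ⟶ g` between colorings of type `a`. -/
def toYoung {ℓ d : ℕ} {a : Comp ℓ d} {f g : Coloring ℓ d} (hf : type f = a) (hg : type g = a)
    (π : f ⟶ g) : ∀ i, Equiv.Perm (Fin (a.1 i)) :=
  autToYoung (ordIso (type_canon a) hf ≫ π ≫ ordIso hg (type_canon a))

theorem toYoung_id {ℓ d : ℕ} {a : Comp ℓ d} {f : Coloring ℓ d} (hf : type f = a) :
    toYoung hf hf (𝟙 f) = 1 := by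
  rw [toYoung, Category.id_comp, ordIso_trans, ordIso_refl, autToYoung_id]

theorem toYoung_comp {ℓ d : ℕ} {a : Comp ℓ d} {f g h : Coloring ℓ d} (hf : type f = a)
    (hg : type g = a) (hh : type h = a) (π : f ⟶ g) (ρ : g ⟶ h) :
    toYoung hf hh (π ≫ ρ) = toYoung hg hh ρ * toYoung hf hg π := by
  rw [toYoung, toYoung, toYoung, ← autToYoung_comp]
  congr 1
  simp only [Category.assoc]
  rw [← Category.assoc (ordIso hg (type_canon a)), ordIso_trans, ordIso_refl, Category.id_comp]

/-- Isomorphic colorings have the same type. -/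
theorem type_eq_of_hom {ℓ d : ℕ} {f g : Coloring ℓ d} (π : f ⟶ g) : type f = type g :=
  Subtype.ext (funext fun i => Fintype.card_congr (fibreMap π i))

open Classical in
/-- The value of `L_p` at a coloring `f`: the whole Specht module if `f` is of type `a`, and zero
otherwise, as a subspace of the Specht module. -/
def LSub {ℓ d : ℕ} (p : MultiPartition ℓ d) (f : Coloring ℓ d) : Submodule ℂ (MultiSpecht p.2) :=
  if type f = p.1 then ⊤ else ⊥

theorem LSub_eq_top {ℓ d : ℕ} {p : MultiPartition ℓ d} {f : Coloring ℓ d} (hf : type f = p.1) :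
    LSub p f = ⊤ := if_pos hf

theorem LSub_eq_bot {ℓ d : ℕ} {p : MultiPartition ℓ d} {f : Coloring ℓ d} (hf : type f ≠ p.1) :
    LSub p f = ⊥ := if_neg hf

open Classical in
/-- The action of a morphism `π : f ⟶ g` between colorings of type `a`, as an endomorphism of the
Specht module (and zero for colorings of other types). -/
def LAct {ℓ d : ℕ} (p : MultiPartition ℓ d) {f g : Coloring ℓ d} (π : f ⟶ g) :
    MultiSpecht p.2 →ₗ[ℂ] MultiSpecht p.2 :=
  if h : type f = p.1 ∧ type g = p.1 then multiSpechtRep p.2 (toYoung h.1 h.2 π) else 0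

theorem LAct_mem {ℓ d : ℕ} (p : MultiPartition ℓ d) {f g : Coloring ℓ d} (π : f ⟶ g)
    (v : MultiSpecht p.2) : LAct p π v ∈ LSub p g := by
  by_cases hg : type g = p.1
  · rw [LSub_eq_top hg]
    trivial
  · rw [LAct, dif_neg (fun h => hg h.2)]
    exact Submodule.zero_mem _

/-- The functor `L_p` on the groupoid. -/
def LFunctor {ℓ d : ℕ} (p : MultiPartition ℓ d) : Coloring ℓ d ⥤ FGModuleCat.{0} ℂ where
  obj f := FGModuleCat.of ℂ (LSub p f)
  map {f g} π := FGModuleCat.ofHom ((LAct p π).restrict fun v _ => LAct_mem p π v)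
  map_id f := by
    apply FGModuleCat.hom_ext
    ext v
    change LAct p (𝟙 f) v.1 = v.1
    by_cases hf : type f = p.1
    · rw [LAct, dif_pos ⟨hf, hf⟩, toYoung_id, map_one, Module.End.one_apply]
    · have hv : v.1 = 0 := (Submodule.mem_bot ℂ).1 (LSub_eq_bot hf ▸ v.2)
      rw [hv, map_zero]
  map_comp {f g h} π ρ := by
    apply FGModuleCat.hom_ext
    ext v
    change LAct p (π ≫ ρ) v.1 = LAct p ρ (LAct p π v.1)
    have hfg := type_eq_of_hom π
    have hgh := type_eq_of_hom ρ
    by_cases hf : type f = p.1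
    · have hg : type g = p.1 := hfg.symm.trans hf
      have hh : type h = p.1 := hgh.symm.trans hg
      rw [LAct, dif_pos ⟨hf, hh⟩, LAct, dif_pos ⟨hg, hh⟩, LAct, dif_pos ⟨hf, hg⟩,
        toYoung_comp hf hg hh, map_mul, Module.End.mul_apply]
    · have hv : v.1 = 0 := (Submodule.mem_bot ℂ).1 (LSub_eq_bot hf ▸ v.2)
      rw [hv, map_zero, map_zero, map_zero]

/-- The `ℂ𝒢_{(ℓ,d)}`-module `L_p`. -/
def L {ℓ d : ℕ} (p : MultiPartition ℓ d) : GMod ℓ d := linExt (LFunctor p)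

/-! ## The generalized symmetric group -/

/-- The wreath product `S(ℓ,d)` of the group of complex `ℓ`-th roots of unity with `S_d`, which
acts on `d`-tuples of roots of unity by permuting the entries. The element `⟨z, σ⟩` corresponds to
the monomial matrix `diag(z) · σ`. -/
abbrev Wreath (ℓ d : ℕ) : Type :=
  (Fin d → rootsOfUnity ℓ ℂ) ⋊[mulAutArrow] Equiv.Perm (Fin d)

/-- The coloring `f ∘ σ`, for which `σ` is a morphism to `f`. -/
def pull {ℓ d : ℕ} (σ : Equiv.Perm (Fin d)) (f : Coloring ℓ d) : Coloring ℓ d :=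
  ⟨fun x => f (σ x)⟩

/-- `σ` as a morphism `f ∘ σ ⟶ f`. -/
def pullHom {ℓ d : ℕ} (σ : Equiv.Perm (Fin d)) (f : Coloring ℓ d) : pull σ f ⟶ f :=
  ⟨σ, fun _ => rfl⟩

/-- The scalar by which the diagonal matrix `diag(z)` acts on the value of a module at `f`: the
product of `z_j ^ f(j)` over all points `j`, where the colors are numbered from `1` to `ℓ` (hence
the shift by one). -/
def weight {ℓ d : ℕ} (z : Fin d → rootsOfUnity ℓ ℂ) (f : Coloring ℓ d) : ℂ :=
  ∏ j, (((z j : ℂˣ) : ℂ) ^ ((f j : ℕ) + 1))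

theorem weight_one {ℓ d : ℕ} (f : Coloring ℓ d) : weight 1 f = 1 := by
  simp [weight]

theorem weight_mul {ℓ d : ℕ} (z w : Fin d → rootsOfUnity ℓ ℂ) (σ : Equiv.Perm (Fin d))
    (f : Coloring ℓ d) :
    weight (z * mulAutArrow σ w) f = weight z f * weight w (pull σ f) := by
  have h : weight w (pull σ f) = ∏ j, (((w (σ⁻¹ j) : ℂˣ) : ℂ) ^ ((f j : ℕ) + 1)) := by
    refine Fintype.prod_equiv σ _ _ fun j => ?_
    simp [pull]
  rw [h, weight, weight, ← Finset.prod_mul_distrib]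
  refine Finset.prod_congr rfl fun j _ => ?_
  rw [← mul_pow]
  rfl

theorem act_id {ℓ d : ℕ} (M : GMod ℓ d) (f : Coloring ℓ d) (v : M.val f) :
    M.act (𝟙 f) v = v := by
  have h : M.obj.map ((Free.embedding ℂ (Coloring ℓ d)).map (𝟙 f)) = 𝟙 _ := by
    rw [CategoryTheory.Functor.map_id, CategoryTheory.Functor.map_id]
  exact LinearMap.congr_fun (congrArg (fun u => u.hom.hom) h) v

theorem act_comp {ℓ d : ℕ} (M : GMod ℓ d) {f g h : Coloring ℓ d} (π : f ⟶ g) (ρ : g ⟶ h)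
    (v : M.val f) : M.act (π ≫ ρ) v = M.act ρ (M.act π v) := by
  have h : M.obj.map ((Free.embedding ℂ (Coloring ℓ d)).map (π ≫ ρ)) =
      M.obj.map ((Free.embedding ℂ (Coloring ℓ d)).map π) ≫
        M.obj.map ((Free.embedding ℂ (Coloring ℓ d)).map ρ) := by
    rw [CategoryTheory.Functor.map_comp, CategoryTheory.Functor.map_comp]
  exact LinearMap.congr_fun (congrArg (fun u => u.hom.hom) h) v

/-- The representation of `S(ℓ,d)` on the (finite) direct sum of the spaces `M(f)` that corresponds
to a `ℂ𝒢_{(ℓ,d)}`-module `M` under the isomorphism from `ℂ[S(ℓ,d)]` onto the algebra of the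
groupoid which sends `σ ∈ S_d` to the sum of all morphisms `σ : f ∘ σ ⟶ f` and the diagonal
matrix with first entry `ξ` and other entries `1` to the sum over all colorings `f` of
`ξ ^ f(1)` times the identity of `f`, the colors being numbered from `1` to `ℓ`. -/
def wreathRep {ℓ d : ℕ} (M : GMod ℓ d) :
    Representation ℂ (Wreath ℓ d) (∀ f : Coloring ℓ d, M.val f) where
  toFun w := LinearMap.pi fun f =>
    weight w.left f • (M.act (pullHom w.right f) ∘ₗ LinearMap.proj (pull w.right f))
  map_one' := by
    refine LinearMap.ext fun v => funext fun f => ?_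
    change weight 1 f • M.act (𝟙 f) (v f) = v f
    rw [weight_one, one_smul, act_id]
  map_mul' w w' := by
    refine LinearMap.ext fun v => funext fun f => ?_
    change weight (w.left * mulAutArrow w.right w'.left) f •
        M.act (pullHom w'.right (pull w.right f) ≫ pullHom w.right f)
          (v (pull w'.right (pull w.right f))) =
      weight w.left f • M.act (pullHom w.right f) (weight w'.left (pull w.right f) •
        M.act (pullHom w'.right (pull w.right f)) (v (pull w'.right (pull w.right f))))
    rw [weight_mul, act_comp, map_smul, smul_smul]

end

end GenSym

namespace GenSym

noncomputable section

/-! ## Irreducibility of Specht modules -/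

/-! Two colorings are isomorphic exactly when their types agree, and the automorphism group of a
coloring of type `a` is the Young subgroup of `a`. A module over the groupoid is therefore
determined by one representation of a Young subgroup for each type, and a simple module lives on a
single type, where it is an irreducible representation.

The irreducible representations of a Young subgroup are the outer tensor products of Specht modules.
For one factor, James' argument with the signed column sums `κ_t` gives irreducibility
(`spechtRep_isIrreducible`) and pairwise non-isomorphism (`eq_of_spechtRep_equiv`). Characters of
outer tensor products are products, so orthogonality carries both facts over to several factors.
Completeness is a count: tuples of cycle types separate conjugacy classes and are indexed by the
same set as the tensor products (`exists_intertwiningMap_ne_zero`).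

For the wreath product, the characters of the diagonal subgroup are the weights of the colorings.
Every representation is the sum of its weight spaces, and a permutation `σ` carries the weight space
of `f ∘ σ` to that of `f`. Thus the weight spaces carry an action of the groupoid, and `wreathRep`
reassembles a representation from such an action. Both classifications rest on `L_submodule_eq_top`,
`L_eq_of_natural` and `exists_natural_from_L`, which speak of families of subspaces and of linear
maps so that they serve modules and weight spaces alike. -/

theorem isIrreducible_of_forall_submodule {G V : Type*} [Group G] [AddCommGroup V] [Module ℂ V]
    (ρ : Representation ℂ G V) [Nontrivial V]
    (h : ∀ U : Submodule ℂ V, (∀ g, ∀ v ∈ U, ρ g v ∈ U) → U ≠ ⊥ → U = ⊤) : ρ.IsIrreducible where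
  exists_pair_ne := ⟨⊥, ⊤, fun e => bot_ne_top (α := Submodule ℂ V)
    (congrArg Subrepresentation.toSubmodule e)⟩
  eq_bot_or_eq_top U := by
    by_cases hU : U.toSubmodule = ⊥
    · exact Or.inl (Subrepresentation.toSubmodule_injective hU)
    · exact Or.inr (Subrepresentation.toSubmodule_injective
        (h U.toSubmodule (fun g _ hv => U.apply_mem_toSubmodule g hv) hU))

theorem nontrivial_of_isIrreducible {G V : Type*} [Group G] [AddCommGroup V] [Module ℂ V]
    (ρ : Representation ℂ G V)
    [hρ : ρ.IsIrreducible] : Nontrivial V := by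
  by_contra hV
  rw [not_nontrivial_iff_subsingleton] at hV
  obtain ⟨x, y, hxy⟩ := hρ.exists_pair_ne
  exact hxy (Subrepresentation.toSubmodule_injective (Subsingleton.elim _ _))

/-! ### Combinatorics of tableaux and tabloids -/

section Combinatorics

variable {n : ℕ} {μ ν : Nat.Partition n}

theorem Tableau.sum_row_col {β : Type*} [AddCommMonoid β] (t : Tableau μ) (h : ℕ × ℕ → β) :
    ∑ x, h (t.row x, t.col x) = ∑ c ∈ (diagram μ).cells, h c := by
  rw [← Finset.sum_coe_sort (diagram μ).cells]
  exact Fintype.sum_equiv t.symm _ _ fun x => rfl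

theorem card_diagram (μ : Nat.Partition n) : (diagram μ).cells.card = n := by
  set w := μ.parts.sort (· ≥ ·) with hw
  have e : {c : ℕ × ℕ // c ∈ (diagram μ).cells} ≃ (i : Fin w.length) × Fin w[i] :=
    { toFun := fun c => ⟨⟨c.1.1, (YoungDiagram.mem_ofRowLens.1 c.2).1⟩,
        ⟨c.1.2, (YoungDiagram.mem_ofRowLens.1 c.2).2⟩⟩
      invFun := fun y => ⟨(y.1, y.2), YoungDiagram.mem_ofRowLens.2 ⟨y.1.2, y.2.2⟩⟩
      left_inv := fun _ => rfl
      right_inv := fun _ => rfl }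
  rw [← Fintype.card_coe, Fintype.card_congr e, Fintype.card_sigma]
  simp only [Fintype.card_fin]
  have h1 : ∑ i : Fin w.length, w[i] = w.sum := by simp
  rw [h1, ← Multiset.sum_coe, hw, Multiset.sort_eq, μ.parts_sum]

instance (μ : Nat.Partition n) : Nonempty (Tableau μ) :=
  ⟨Fintype.equivFinOfCardEq (by rw [Fintype.card_coe, card_diagram])⟩

/-- A partition is determined by the lengths of the rows of its diagram. -/
theorem eq_of_rowLen_eq (h : ∀ i, (diagram μ).rowLen i = (diagram ν).rowLen i) : μ = ν := by
  have hd : diagram μ = diagram ν := by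
    ext ⟨i, j⟩
    rw [YoungDiagram.mem_cells, YoungDiagram.mem_cells, YoungDiagram.mem_iff_lt_rowLen,
      YoungDiagram.mem_iff_lt_rowLen, h]
  have hs : μ.parts.sort (· ≥ ·) = ν.parts.sort (· ≥ ·) := by
    have h1 := congrArg YoungDiagram.rowLens hd
    rwa [diagram, diagram, YoungDiagram.rowLens_ofRowLens_eq_self,
      YoungDiagram.rowLens_ofRowLens_eq_self] at h1
    · exact fun x hx => ν.parts_pos ((Multiset.mem_sort _).1 hx)
    · exact fun x hx => μ.parts_pos ((Multiset.mem_sort _).1 hx)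
  apply Nat.Partition.ext
  rw [← Multiset.sort_eq μ.parts (· ≥ ·), hs, Multiset.sort_eq]

theorem Tableau.card_row_eq (t : Tableau μ) (i : ℕ) :
    (Finset.univ.filter fun x => t.row x = i).card = (diagram μ).rowLen i := by
  rw [YoungDiagram.rowLen_eq_card, Finset.card_filter,
    t.sum_row_col (fun c => if c.1 = i then 1 else 0), ← Finset.card_filter]
  rfl

theorem Tableau.shape_eq_of_row_comp (t : Tableau μ) (s : Tableau ν) (π : Equiv.Perm (Fin n))
    (h : ∀ x, t.row (π x) = s.row x) : μ = ν := by
  refine eq_of_rowLen_eq fun i => ?_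
  rw [← t.card_row_eq, ← s.card_row_eq]
  refine (Finset.card_equiv π fun x => ?_).symm
  simp [h]

/-- If a tabloid has no two entries in the same row which are in the same column of `t`, then the
sum of the row numbers of its entries is at least the one for `t`, and in case of equality the
tabloid arises from `t` by a column permutation. -/
theorem Tableau.exists_colStab (t : Tableau μ) (r : Fin n → ℕ)
    (hinj : Function.Injective fun x => (r x, t.col x)) :
    ∑ x, t.row x ≤ ∑ x, r x ∧
      (∑ x, r x ≤ ∑ x, t.row x → ∃ π ∈ t.colStab, ∀ x, t.row (π x) = r x) := by
  classical
  set D := (diagram μ).cells with hD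
  set A := Finset.univ.image fun x => (r x, t.col x) with hA
  -- Subtracting the column length does not change the difference of the two row sums, because `A`
  -- and `D` use the same column labels. The new weight is at most `-1` inside the diagram and at
  -- least `0` outside, so every cell of `D \ A` raises the row sum by at least one.
  let h : ℕ × ℕ → ℤ := fun c => (c.1 : ℤ) - (diagram μ).colLen c.2
  have hcard : A.card = D.card := by
    rw [hA, Finset.card_image_of_injective _ hinj, hD, card_diagram, Finset.card_univ,
      Fintype.card_fin]
  have hsumA : ∑ c ∈ A, h c = ∑ x, h (r x, t.col x) := Finset.sum_image fun x _ y _ e => hinj e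
  have hsumD := t.sum_row_col h
  have hdiff : (∑ x, (r x : ℤ)) - ∑ x, (t.row x : ℤ) = ∑ c ∈ A, h c - ∑ c ∈ D, h c := by
    rw [hsumA, ← hsumD]
    simp only [h, Finset.sum_sub_distrib]
    ring
  have hD1 : ∑ c ∈ D \ A, h c ≤ ∑ c ∈ D \ A, (-1 : ℤ) := by
    refine Finset.sum_le_sum fun c hc => ?_
    have hc' : (c.1, c.2) ∈ diagram μ := (Finset.mem_sdiff.1 hc).1
    rw [YoungDiagram.mem_iff_lt_colLen] at hc'
    simp only [h]
    lia
  have hA1 : 0 ≤ ∑ c ∈ A \ D, h c := by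
    refine Finset.sum_nonneg fun c hc => ?_
    have hc' : ¬ (c.1, c.2) ∈ diagram μ := (Finset.mem_sdiff.1 hc).2
    rw [YoungDiagram.mem_iff_lt_colLen] at hc'
    simp only [h]
    lia
  have hsd := Finset.sum_sdiff_sub_sum_sdiff (s₁ := D) (s₂ := A) (f := h)
  rw [Finset.sum_const, nsmul_eq_mul, mul_neg_one] at hD1
  have key : ((D \ A).card : ℤ) ≤ (∑ x, (r x : ℤ)) - ∑ x, (t.row x : ℤ) := by lia
  refine ⟨by zify; lia, fun hle => ?_⟩
  have h0 : (D \ A).card = 0 := by zify at hle ⊢; lia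
  have hAD : D = A := Finset.eq_of_subset_of_card_le
    (Finset.sdiff_eq_empty_iff_subset.1 (Finset.card_eq_zero.1 h0)) hcard.le
  have hmem : ∀ x, (r x, t.col x) ∈ (diagram μ).cells := fun x => by
    rw [← hD, hAD]
    exact Finset.mem_image_of_mem _ (Finset.mem_univ x)
  -- Each entry moves within its column of `t` to the row that `r` prescribes.
  let g : Fin n → Fin n := fun x => t ⟨(r x, t.col x), hmem x⟩
  have hg : Function.Injective g := fun x y e => hinj (Subtype.ext_iff.1 (t.injective e))
  refine ⟨Equiv.ofBijective g (Finite.injective_iff_bijective.1 hg), fun x => ?_, fun x => ?_⟩ <;>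
    simp [g, Tableau.row, Tableau.col]

end Combinatorics

/-! ### Signed column sums and James' argument for Specht modules -/

section Antisymmetrizer

variable {n : ℕ} {μ ν : Nat.Partition n} {V W : Type*} [AddCommGroup V] [Module ℂ V]
  [AddCommGroup W] [Module ℂ W]

open Classical in
/-- The signed column sum `κ_t` in a representation of the symmetric group. -/
def colAntisym (t : Tableau μ) (ρ : Representation ℂ (Equiv.Perm (Fin n)) V) : V →ₗ[ℂ] V :=
  ∑ π : t.colStab, ((Equiv.Perm.sign π.1 : ℤ) : ℂ) • ρ π.1

theorem colAntisym_apply (t : Tableau μ) (ρ : Representation ℂ (Equiv.Perm (Fin n)) V) (v : V)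
    [Fintype t.colStab] :
    colAntisym t ρ v = ∑ π : t.colStab, ((Equiv.Perm.sign π.1 : ℤ) : ℂ) • ρ π.1 v := by
  simp only [colAntisym, LinearMap.sum_apply, LinearMap.smul_apply]
  exact Finset.sum_congr (by ext; simp) fun _ _ => rfl

theorem colAntisym_map (t : Tableau μ) {ρ : Representation ℂ (Equiv.Perm (Fin n)) V}
    {σ : Representation ℂ (Equiv.Perm (Fin n)) W} (φ : V →ₗ[ℂ] W)
    (hφ : ∀ g v, φ (ρ g v) = σ g (φ v)) (v : V) :
    φ (colAntisym t ρ v) = colAntisym t σ (φ v) := by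
  classical
  simp [colAntisym_apply, hφ]

/-- Right multiplication by `σ` permutes the column stabilizer and multiplies each sign by that of
`σ`. -/
theorem colAntisym_mul (t : Tableau μ) (ρ : Representation ℂ (Equiv.Perm (Fin n)) V)
    {σ : Equiv.Perm (Fin n)} (hσ : σ ∈ t.colStab) (v : V) :
    colAntisym t ρ (ρ σ v) = ((Equiv.Perm.sign σ : ℤ) : ℂ) • colAntisym t ρ v := by
  classical
  rw [colAntisym_apply, colAntisym_apply, Finset.smul_sum]
  refine Fintype.sum_equiv (Equiv.mulRight ⟨σ, hσ⟩) _ _ fun π => ?_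
  have hs : ((Equiv.Perm.sign σ : ℤ) : ℂ) * ((Equiv.Perm.sign σ : ℤ) : ℂ) = 1 := by
    rw [← Int.cast_mul, ← Units.val_mul, Int.units_mul_self]
    simp
  simp only [Equiv.coe_mulRight, Subgroup.coe_mul, map_mul, Module.End.mul_apply, smul_smul,
    Units.val_mul, Int.cast_mul]
  rw [mul_left_comm, hs, mul_one]

theorem tabloidRep_single (σ : Equiv.Perm (Fin n)) (r : Tabloid μ) (c : ℂ) :
    tabloidRep μ σ (Finsupp.single r c) = Finsupp.single (σ • r) c := by
  simp [tabloidRep]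

theorem tabloidRep_apply (σ : Equiv.Perm (Fin n)) (u : Tabloid μ →₀ ℂ) (r : Tabloid μ) :
    tabloidRep μ σ u (σ • r) = u r :=
  Finsupp.mapDomain_apply (MulAction.injective σ) u r

theorem polytabloid_eq (t : Tableau μ) :
    t.polytabloid = colAntisym t (tabloidRep μ) (Finsupp.single t.tabloid 1) := by
  classical
  rw [colAntisym_apply, Tableau.polytabloid, ← Finset.sum_filter]
  rw [Finset.sum_subtype _ (p := (· ∈ t.colStab)) (by simp)]
  refine Finset.sum_congr rfl fun π _ => ?_
  simp [tabloidRep_single]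

theorem tabloid_sum_row (r : Tabloid μ) : ∑ x, r.1 x = ∑ c ∈ (diagram μ).cells, c.1 := by
  obtain ⟨t, ht⟩ := r.2
  rw [← t.sum_row_col, ← ht]

/-- A tabloid which is not killed by `κ_t` has no two entries in the same row that are in the same
column of `t`. -/
theorem injective_of_colAntisym_ne_zero (t : Tableau μ) (r : Tabloid ν)
    (h : colAntisym t (tabloidRep ν) (Finsupp.single r 1) ≠ 0) :
    Function.Injective fun x => (r.1 x, t.col x) := by
  intro x y hxy
  by_contra hne
  obtain ⟨h1, h2⟩ := Prod.ext_iff.1 hxy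
  dsimp only at h1 h2
  -- The transposition of two offending entries lies in the column stabilizer and fixes `r`, so `κ_t
  -- r = -κ_t r`.
  have hmem : Equiv.swap x y ∈ t.colStab := fun z => by
    by_cases hzx : z = x
    · rw [hzx, Equiv.swap_apply_left, h2]
    · by_cases hzy : z = y
      · rw [hzy, Equiv.swap_apply_right, h2]
      · rw [Equiv.swap_apply_of_ne_of_ne hzx hzy]
  have hfix : Equiv.swap x y • r = r := by
    apply Subtype.ext
    funext z
    change r.1 ((Equiv.swap x y)⁻¹ z) = r.1 z
    rw [Equiv.swap_inv]
    by_cases hzx : z = x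
    · rw [hzx, Equiv.swap_apply_left, h1]
    · by_cases hzy : z = y
      · rw [hzy, Equiv.swap_apply_right, h1]
      · rw [Equiv.swap_apply_of_ne_of_ne hzx hzy]
  have h3 := colAntisym_mul t (tabloidRep ν) hmem (Finsupp.single r 1)
  rw [tabloidRep_single, hfix, Equiv.Perm.sign_swap hne] at h3
  simp only [Units.val_neg, Units.val_one, Int.cast_neg, Int.cast_one, neg_smul, one_smul] at h3
  exact h (self_eq_neg.1 h3)

/-- All tabloids of one shape have the same row sum. A tabloid not killed by `κ_t` is thus in the
equality case of `Tableau.exists_colStab`: it is a column permutation of `t.tabloid`, and `κ_t`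
sends it to `± e_t`. -/
theorem colAntisym_mem_span (t : Tableau μ) (v : Tabloid μ →₀ ℂ) :
    colAntisym t (tabloidRep μ) v ∈ Submodule.span ℂ {t.polytabloid} := by
  induction v using Finsupp.induction_linear with
  | zero => simp
  | add u v hu hv => rw [map_add]; exact Submodule.add_mem _ hu hv
  | single r c =>
    rw [← mul_one c, ← smul_eq_mul, ← Finsupp.smul_single, map_smul]
    refine Submodule.smul_mem _ _ ?_
    by_cases h : colAntisym t (tabloidRep μ) (Finsupp.single r 1) = 0
    · rw [h]; exact Submodule.zero_mem _
    · have hle : ∑ x, r.1 x ≤ ∑ x, t.row x := by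
        rw [tabloid_sum_row, ← tabloid_sum_row t.tabloid]
        exact le_rfl
      obtain ⟨π, hπ, hr⟩ :=
        (t.exists_colStab r.1 (injective_of_colAntisym_ne_zero t r h)).2 hle
      have he : r = π⁻¹ • t.tabloid := by
        apply Subtype.ext
        funext x
        change r.1 x = t.row (π⁻¹⁻¹ x)
        rw [inv_inv, hr]
      rw [he, ← tabloidRep_single, colAntisym_mul t _ (inv_mem hπ), ← polytabloid_eq]
      exact Submodule.smul_mem _ _ (Submodule.mem_span_singleton_self _)

/-- The pairing of a vector with a polytabloid is a coefficient of its signed column sum. -/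
theorem colAntisym_apply_tabloid (t : Tableau μ) (u : Tabloid μ →₀ ℂ) :
    colAntisym t (tabloidRep μ) u t.tabloid = t.polytabloid.sum fun r c => c * u r := by
  classical
  have hl : (t.polytabloid.sum fun r c => c * u r) =
      Finsupp.linearCombination ℂ (fun r => u r) t.polytabloid := rfl
  rw [hl, polytabloid_eq, colAntisym_apply, colAntisym_apply, map_sum, Finsupp.finsetSum_apply]
  refine Fintype.sum_equiv (Equiv.inv _) _ _ fun π => ?_
  have h1 : tabloidRep μ π.1 u t.tabloid = u ((π⁻¹).1 • t.tabloid) := by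
    rw [← tabloidRep_apply π.1 u, ← mul_smul]
    simp
  simp [tabloidRep_single, h1]

/-- The coefficients are integers. This lets the bilinear pairing with polytabloids be read as a
positive definite Hermitian form. -/
theorem polytabloid_conj (t : Tableau μ) (r : Tabloid μ) :
    (starRingEnd ℂ) (t.polytabloid r) = t.polytabloid r := by
  classical
  rw [polytabloid_eq, colAntisym_apply, Finsupp.finsetSum_apply, map_sum]
  refine Finset.sum_congr rfl fun π _ => ?_
  rw [tabloidRep_single]
  simp only [Finsupp.smul_apply, Finsupp.single_apply, smul_eq_mul, map_mul]
  split_ifs <;> simp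

/-- Only the identity preserves both the row and the column of every entry of `t`. -/
theorem polytabloid_apply_tabloid (t : Tableau μ) : t.polytabloid t.tabloid = 1 := by
  classical
  rw [polytabloid_eq, colAntisym_apply, Finsupp.finsetSum_apply,
    Finset.sum_eq_single (1 : t.colStab)]
  · simp
  · intro π _ hπ
    rw [tabloidRep_single, Finsupp.smul_apply, Finsupp.single_apply, if_neg, smul_zero]
    intro he
    apply hπ
    apply Subtype.ext
    ext1 x
    have h1 : t.row (π.1 x) = t.row x := by
      have := congrFun (congrArg Subtype.val he) (π.1 x)
      change t.row (π.1⁻¹ (π.1 x)) = t.row (π.1 x) at this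
      rw [← this]
      simp
    exact t.symm.injective (Subtype.ext (Prod.ext h1 (π.2 x)))
  · simp

theorem polytabloid_ne_zero (t : Tableau μ) : t.polytabloid ≠ 0 := fun h => by
  have := polytabloid_apply_tabloid t
  simp [h] at this

theorem polytabloid_mem (t : Tableau μ) : t.polytabloid ∈ spechtSubmodule μ :=
  Submodule.subset_span ⟨t, rfl⟩

/-- An invariant subspace of the permutation module on tabloids containing one polytabloid
contains the Specht module. -/
theorem spechtSubmodule_le (U : Submodule ℂ (Tabloid μ →₀ ℂ))
    (hU : ∀ σ, ∀ v ∈ U, tabloidRep μ σ v ∈ U) (t : Tableau μ) (ht : t.polytabloid ∈ U) :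
    spechtSubmodule μ ≤ U := by
  rw [spechtSubmodule, Submodule.span_le]
  rintro _ ⟨s, rfl⟩
  have : s = t.trans (t.symm.trans s) := by ext; simp
  rw [this, ← tabloidRep_polytabloid]
  exact hU _ _ ht

/-- An element of the Specht module orthogonal to all polytabloids vanishes. -/
theorem eq_zero_of_forall_polytabloid {u : Tabloid μ →₀ ℂ} (hu : u ∈ spechtSubmodule μ)
    (h : ∀ t : Tableau μ, (t.polytabloid.sum fun r c => c * u r) = 0) : u = 0 := by
  -- Conjugation does nothing on polytabloids, so the hypothesis extends conjugate-linearly to their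
  -- span. Taking `v = u` then gives a vanishing sum of squared absolute values.
  have key : ∀ v ∈ spechtSubmodule μ, (v.sum fun r c => (starRingEnd ℂ) c * u r) = 0 := by
    intro v hv
    induction hv using Submodule.span_induction with
    | mem x hx =>
      obtain ⟨t, rfl⟩ := hx
      rw [← h t]
      refine Finsupp.sum_congr fun r _ => ?_
      rw [polytabloid_conj]
    | zero => simp
    | add v w _ _ hv hw =>
      classical
      rw [Finsupp.sum_add_index, hv, hw, add_zero]
      · simp
      · intros; rw [map_add, add_mul]
    | smul c v _ hv =>
      rw [Finsupp.sum_smul_index (by simp)]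
      simp only [map_mul, mul_assoc]
      rw [← Finsupp.mul_sum, hv, mul_zero]
  have h0 := key u hu
  simp only [Finsupp.sum, ← Complex.normSq_eq_conj_mul_self] at h0
  rw [← Complex.ofReal_sum, Complex.ofReal_eq_zero,
    Finset.sum_eq_zero_iff_of_nonneg fun _ _ => Complex.normSq_nonneg _] at h0
  ext r
  by_contra hr
  exact hr (Complex.normSq_eq_zero.1 (h0 r (Finsupp.mem_support_iff.2 hr)))

/-- The inclusion of the Specht module into the permutation module on tabloids. -/
def spechtIncl (μ : Nat.Partition n) : Specht μ →ₗ[ℂ] (Tabloid μ →₀ ℂ) :=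
  (spechtSubmodule μ).subtype

theorem spechtIncl_injective (μ : Nat.Partition n) : Function.Injective (spechtIncl μ) :=
  Subtype.val_injective

theorem spechtIncl_spechtRep (σ : Equiv.Perm (Fin n)) (v : Specht μ) :
    spechtIncl μ (spechtRep μ σ v) = tabloidRep μ σ (spechtIncl μ v) := rfl

instance (μ : Nat.Partition n) : Nontrivial (Specht μ) :=
  let t := Classical.arbitrary (Tableau μ)
  ⟨⟨t.polytabloid, polytabloid_mem t⟩, 0, fun h => polytabloid_ne_zero t (Subtype.ext_iff.1 h)⟩

/-- A nonzero vector `u` of an invariant subspace is not orthogonal to every polytabloid, so `κ_t u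
≠ 0` for some `t`. This vector lies in the subspace and is a multiple of `e_t`, which generates the
Specht module. -/
instance spechtRep_isIrreducible (μ : Nat.Partition n) : (spechtRep μ).IsIrreducible := by
  refine isIrreducible_of_forall_submodule _ fun U hU hne => ?_
  obtain ⟨u, hu, hu0⟩ := (Submodule.ne_bot_iff U).1 hne
  have hU' : ∀ σ, ∀ v ∈ U.map (spechtIncl μ), tabloidRep μ σ v ∈ U.map (spechtIncl μ) := by
    rintro σ _ ⟨v, hv, rfl⟩
    exact ⟨_, hU σ v hv, rfl⟩
  have hex : ∃ t : Tableau μ, colAntisym t (tabloidRep μ) (spechtIncl μ u) ≠ 0 := by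
    by_contra! hall
    refine hu0 (spechtIncl_injective μ ?_)
    rw [map_zero]
    refine eq_zero_of_forall_polytabloid u.2 fun t => ?_
    rw [← colAntisym_apply_tabloid]
    exact DFunLike.congr_fun (hall t) _
  obtain ⟨t, ht⟩ := hex
  obtain ⟨c, hc⟩ := Submodule.mem_span_singleton.1 (colAntisym_mem_span t (spechtIncl μ u))
  have hc0 : c ≠ 0 := fun h => ht (by rw [← hc, h, zero_smul])
  have hmem : colAntisym t (tabloidRep μ) (spechtIncl μ u) ∈ U.map (spechtIncl μ) := by
    classical
    rw [colAntisym_apply]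
    exact Submodule.sum_mem _ fun π _ => Submodule.smul_mem _ _ (hU' _ _ ⟨u, hu, rfl⟩)
  rw [← hc, Submodule.smul_mem_iff _ hc0] at hmem
  have hle := spechtSubmodule_le _ hU' t hmem
  refine (Submodule.eq_top_iff'.2 fun v => ?_)
  obtain ⟨w, hw, hwv⟩ := hle v.2
  rwa [← spechtIncl_injective μ hwv]

/-- The map is injective by irreducibility and commutes with `κ_t`, which does not kill `e_t`. So
`κ_t` cannot vanish on all tabloids of shape `ν`. -/
theorem exists_tabloid_injective_of_intertwiningMap (φ : (spechtRep μ).IntertwiningMap (spechtRep ν))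
    (hφ : φ ≠ 0) (t : Tableau μ) :
    ∃ r : Tabloid ν, Function.Injective fun x => (r.1 x, t.col x) := by
  let ψ : Specht μ →ₗ[ℂ] (Tabloid ν →₀ ℂ) := spechtIncl ν ∘ₗ φ.toLinearMap
  have hψ : ∀ g v, ψ (spechtRep μ g v) = tabloidRep ν g (ψ v) := fun g v => by
    change spechtIncl ν (φ (spechtRep μ g v)) = _
    rw [φ.isIntertwining]
    rfl
  have hinj : Function.Injective ψ :=
    (spechtIncl_injective ν).comp
      ((Representation.IsIrreducible.injective_or_eq_zero φ).resolve_right hφ)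
  let e : Specht μ := ⟨t.polytabloid, polytabloid_mem t⟩
  have he : colAntisym t (spechtRep μ) e ≠ 0 := fun h => by
    classical
    have h1 := congrArg (spechtIncl μ) h
    rw [colAntisym_map t _ spechtIncl_spechtRep, map_zero] at h1
    change colAntisym t (tabloidRep μ) t.polytabloid = 0 at h1
    -- This is the relation `κ_t² = |C_t| κ_t`: each term contributes the square of a sign.
    have h2 : colAntisym t (tabloidRep μ) t.polytabloid =
        (Fintype.card t.colStab : ℂ) • t.polytabloid := by
      nth_rw 1 [polytabloid_eq, colAntisym_apply t _ (Finsupp.single _ _), map_sum]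
      simp only [map_smul]
      rw [Finset.sum_congr rfl fun π _ => by
        rw [colAntisym_mul t _ π.2, smul_smul, ← Int.cast_mul, ← Units.val_mul,
          Int.units_mul_self, Units.val_one, Int.cast_one, one_smul, ← polytabloid_eq]]
      simp [Nat.cast_smul_eq_nsmul]
    rw [h2] at h1
    exact (smul_ne_zero (Nat.cast_ne_zero.2 Fintype.card_ne_zero) (polytabloid_ne_zero t)) h1
  have hne : colAntisym t (tabloidRep ν) (ψ e) ≠ 0 := fun h => he (hinj (by
    rw [colAntisym_map t ψ hψ, h, map_zero]))
  by_contra! hall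
  apply hne
  have hz : colAntisym t (tabloidRep ν) = 0 := by
    refine Finsupp.lhom_ext fun r c => ?_
    rw [← mul_one c, ← smul_eq_mul, ← Finsupp.smul_single, map_smul]
    by_contra h
    exact hall r (injective_of_colAntisym_ne_zero t r fun h' => h (by simp [h']))
  rw [hz, LinearMap.zero_apply]

/-- The row sum of a diagram takes the place of the dominance order. Maps in both directions bound
the row sums of `μ` and `ν` by each other, and the equality case of `Tableau.exists_colStab` matches
the row lengths. -/
theorem eq_of_spechtRep_equiv (φ : (spechtRep μ).Equiv (spechtRep ν)) : μ = ν := by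
  have aux : ∀ {μ ν : Nat.Partition n} (φ : (spechtRep μ).Equiv (spechtRep ν)),
      φ.toIntertwiningMap ≠ 0 := fun φ h => by
    obtain ⟨v, hv⟩ := exists_ne (0 : Specht _)
    refine hv (φ.toLinearEquiv.injective ?_)
    rw [map_zero]
    exact DFunLike.congr_fun h v
  have t := Classical.arbitrary (Tableau μ)
  have s := Classical.arbitrary (Tableau ν)
  obtain ⟨r, hr⟩ := exists_tabloid_injective_of_intertwiningMap _ (aux φ) t
  obtain ⟨q, hq⟩ := exists_tabloid_injective_of_intertwiningMap _ (aux φ.symm) s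
  have h1 : ∑ x, r.1 x ≤ ∑ x, t.row x := by
    have := (s.exists_colStab q.1 hq).1
    rw [tabloid_sum_row] at this ⊢
    rw [show ∑ x, t.row x = ∑ x, t.tabloid.1 x from rfl, tabloid_sum_row]
    rwa [show ∑ x, s.row x = ∑ x, s.tabloid.1 x from rfl, tabloid_sum_row] at this
  obtain ⟨π, -, hπ⟩ := (t.exists_colStab r.1 hr).2 h1
  obtain ⟨s', hs'⟩ := r.2
  exact t.shape_eq_of_row_comp s' π fun x => by rw [hπ, hs']

end Antisymmetrizer

/-! ## Characters of finite groups -/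

section Characters

variable {G : Type*} [Group G] [Finite G]

theorem natCard_ne_zero_complex (G : Type*) [Group G] [Finite G] : (Nat.card G : ℂ) ≠ 0 :=
  Nat.cast_ne_zero.2 Nat.card_pos.ne'

/-- A pairwise non-isomorphic family of irreducible representations, indexed by a set through which
one can separate conjugacy classes, is complete. -/
theorem exists_intertwiningMap_ne_zero {I : Type*} [Finite I] (c : G → I)
    (hc : ∀ g h, c g = c h → IsConj g h) {S : I → Type*} [∀ i, AddCommGroup (S i)]
    [∀ i, Module ℂ (S i)] [∀ i, FiniteDimensional ℂ (S i)] (ρ : ∀ i, Representation ℂ G (S i))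
    (hirr : ∀ i, (ρ i).IsIrreducible) (hne : ∀ i j, Nonempty ((ρ i).Equiv (ρ j)) → i = j)
    {V : Type*} [AddCommGroup V] [Module ℂ V] [FiniteDimensional ℂ V] [Nontrivial V]
    (σ : Representation ℂ G V) : ∃ i, ∃ φ : (ρ i).IntertwiningMap σ, φ ≠ 0 := by
  classical
  have := Fintype.ofFinite G
  have := Fintype.ofFinite I
  let _ := invertibleOfNonzero (natCard_ne_zero_complex G)
  by_contra! hall
  have hσ : ∀ i, ∑ g, σ.character g * (ρ i).character g⁻¹ = 0 := fun i => by
    have h := Representation.card_inv_mul_sum_char_mul_char_eq_finrank (ρ i) σ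
    have : Subsingleton ((ρ i).IntertwiningMap σ) :=
      ⟨fun x y => by rw [hall i x, hall i y]⟩
    rw [Module.finrank_zero_of_subsingleton, Nat.cast_zero] at h
    exact (mul_eq_zero.1 h).resolve_left (inv_ne_zero (natCard_ne_zero_complex G))
  have horth : ∀ i j, ∑ g, (ρ i).character g * (ρ j).character g⁻¹ =
      if i = j then (Nat.card G : ℂ) else 0 := fun i j => by
    have := hirr i
    have := hirr j
    have h := Representation.char_orthonormal (ρ i) (ρ j)
    rw [inv_mul_eq_iff_eq_mul₀ (natCard_ne_zero_complex G)] at h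
    rw [h]
    by_cases hij : i = j
    · subst hij
      rw [if_pos ⟨Representation.Equiv.refl _⟩, if_pos rfl, mul_one]
    · rw [if_neg fun h' => hij (hne _ _ h').symm, if_neg hij, mul_zero]
  have hpair : ∀ (a : I → ℂ) (χ : G → ℂ), (∀ g, χ g = ∑ i, a i * (ρ i).character g) →
      ∀ j, ∑ g, χ g * (ρ j).character g⁻¹ = a j * Nat.card G := fun a χ h j => by
    simp only [h, Finset.sum_mul]
    rw [Finset.sum_comm]
    simp only [mul_assoc, ← Finset.mul_sum, horth]
    simp
  -- Class functions factor through `c`, hence become functions on `I`, set to zero off the range of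
  -- `c`.
  have hfac : ∀ χ : G → ℂ, (∀ g h, χ (h * g * h⁻¹) = χ g) →
      ∀ g, Function.extend c χ 0 (c g) = χ g := fun χ hχ g => by
    refine Function.FactorsThrough.extend_apply (fun x y hxy => ?_) _ _
    obtain ⟨z, hz⟩ := isConj_iff.1 (hc x y hxy)
    rw [← hz, hχ]
  have hfac' := fun i => hfac (ρ i).character (ρ i).char_conj
  let X : I → I → ℂ := fun i => Function.extend c (ρ i).character 0
  have hli : LinearIndependent ℂ X := by
    rw [Fintype.linearIndependent_iff]
    intro a ha j
    have h := hpair a 0 (fun g => by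
      have := congrFun ha (c g)
      simp only [X, Finset.sum_apply, Pi.smul_apply, smul_eq_mul, hfac'] at this
      rw [this]
      rfl) j
    simp only [Pi.zero_apply, zero_mul, Finset.sum_const_zero] at h
    exact (mul_eq_zero.1 h.symm).resolve_right (natCard_ne_zero_complex G)
  -- There are `|I|` independent vectors in the space of functions on `I`, so they span it. The
  -- character of `σ` is then a combination whose coefficients, computed by orthogonality, all
  -- vanish, although its value at `1` is a nonzero dimension.
  have hspan := hli.span_eq_top_of_card_eq_finrank' (by simp)
  obtain ⟨a, ha⟩ := (Submodule.mem_span_range_iff_exists_fun ℂ).1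
    (hspan ▸ Submodule.mem_top : Function.extend c σ.character 0 ∈ Submodule.span ℂ (Set.range X))
  have hχ : ∀ g, σ.character g = ∑ i, a i * (ρ i).character g := fun g => by
    rw [← hfac _ σ.char_conj, ← ha]
    simp [X, hfac']
  have ha0 : ∀ j, a j = 0 := fun j => by
    have h := hpair a _ hχ j
    rw [hσ j] at h
    exact (mul_eq_zero.1 h.symm).resolve_right (natCard_ne_zero_complex G)
  have h1 := hχ 1
  rw [Representation.char_one] at h1
  simp only [ha0, zero_mul, Finset.sum_const_zero, Nat.cast_eq_zero] at h1
  exact Module.finrank_pos.ne' h1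

/-- Norm one says that the endomorphism algebra is one-dimensional. The projection onto an invariant
subspace along an invariant complement is then a scalar, and it is the identity as soon as the
subspace is nonzero. -/
theorem isIrreducible_of_char_norm_one [Fintype G] {V : Type*} [AddCommGroup V] [Module ℂ V]
    [FiniteDimensional ℂ V] (ρ : Representation ℂ G V)
    (h : ∑ g, ρ.character g * ρ.character g⁻¹ = Nat.card G) : ρ.IsIrreducible := by
  let _ := invertibleOfNonzero (natCard_ne_zero_complex G)
  have hfr := Representation.card_inv_mul_sum_char_mul_char_eq_finrank ρ ρ
  rw [h, inv_mul_cancel₀ (natCard_ne_zero_complex G)] at hfr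
  replace hfr : Module.finrank ℂ (ρ.IntertwiningMap ρ) = 1 := by exact_mod_cast hfr.symm
  have hnt : Nontrivial V := by
    by_contra hV
    rw [not_nontrivial_iff_subsingleton] at hV
    have : Subsingleton (ρ.IntertwiningMap ρ) :=
      ⟨fun x y => DFunLike.ext _ _ fun v => Subsingleton.elim _ _⟩
    rw [Module.finrank_zero_of_subsingleton] at hfr
    exact zero_ne_one hfr
  have hid : Representation.IntertwiningMap.id ρ ≠ 0 := fun h0 => by
    obtain ⟨v, hv⟩ := exists_ne (0 : V)
    exact hv (DFunLike.congr_fun h0 v)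
  refine isIrreducible_of_forall_submodule ρ fun U hU hne => ?_
  have : NeZero (Nat.card G : ℂ) := ⟨natCard_ne_zero_complex G⟩
  let U₁ : Subrepresentation ρ := ⟨U, hU⟩
  obtain ⟨U₂, hc⟩ := exists_isCompl U₁
  have hc' : IsCompl U U₂.toSubmodule :=
    ⟨disjoint_iff.2 (congrArg Subrepresentation.toSubmodule hc.disjoint.eq_bot),
      codisjoint_iff.2 (congrArg Subrepresentation.toSubmodule hc.codisjoint.eq_top)⟩
  let P : V →ₗ[ℂ] V := U.subtype ∘ₗ U.projectionOnto U₂.toSubmodule hc'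
  have hP1 : ∀ u ∈ U, P u = u := fun u hu => by
    simp only [P, LinearMap.comp_apply]
    rw [Submodule.projectionOnto_apply_left hc' ⟨u, hu⟩]
    rfl
  have hP2 : ∀ u ∈ U₂.toSubmodule, P u = 0 := fun u hu => by
    simp only [P, LinearMap.comp_apply]
    rw [(Submodule.projectionOnto_apply_eq_zero_iff hc').2 hu, map_zero]
  have hPρ : ∀ g v, P (ρ g v) = ρ g (P v) := fun g v => by
    obtain ⟨u, hu, w, hw, rfl⟩ := Submodule.mem_sup.1
      (hc'.sup_eq_top ▸ Submodule.mem_top : v ∈ U ⊔ U₂.toSubmodule)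
    rw [map_add, map_add, map_add, hP1 _ (hU g u hu), hP2 _ (U₂.apply_mem_toSubmodule g hw),
      hP1 u hu, hP2 w hw, add_zero, add_zero]
  obtain ⟨c, hcP⟩ := (finrank_eq_one_iff_of_nonzero' _ hid).1 hfr
    (P.intertwiningMap_of_isIntertwiningMap ρ ρ hPρ)
  have hcP' : ∀ v, c • v = P v := fun v => DFunLike.congr_fun hcP v
  obtain ⟨u, hu, hu0⟩ := (Submodule.ne_bot_iff U).1 hne
  have hc1 : c = 1 := by
    have := hcP' u
    rw [hP1 u hu] at this
    exact smul_left_injective ℂ hu0 (this.trans (one_smul ℂ u).symm)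
  refine Submodule.eq_top_iff'.2 fun v => ?_
  rw [← one_smul ℂ v, ← hc1, hcP' v]
  exact Submodule.coe_mem _

end Characters

/-! ## Outer tensor products of Specht modules -/

theorem trace_piTensorProduct_map {ι : Type*} [Fintype ι] {M : ι → Type*}
    [∀ i, AddCommGroup (M i)] [∀ i, Module ℂ (M i)] [∀ i, FiniteDimensional ℂ (M i)]
    (φ : ∀ i, M i →ₗ[ℂ] M i) :
    LinearMap.trace ℂ (⨂[ℂ] i, M i) (PiTensorProduct.map φ) =
      ∏ i, LinearMap.trace ℂ (M i) (φ i) := by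
  classical
  let b := fun i => Module.finBasis ℂ (M i)
  rw [LinearMap.trace_eq_matrix_trace ℂ (Basis.piTensorProduct b), Matrix.trace]
  simp only [LinearMap.trace_eq_matrix_trace ℂ (b _), Matrix.trace]
  rw [Finset.prod_univ_sum, Fintype.piFinset_univ]
  refine Finset.sum_congr rfl fun p _ => ?_
  rw [Matrix.diag_apply, LinearMap.toMatrix_apply, Basis.piTensorProduct_apply,
    PiTensorProduct.map_tprod, Basis.piTensorProduct_repr_tprod_apply]
  simp [LinearMap.toMatrix_apply]

section MultiSpecht

variable {ℓ : ℕ} {a : Fin ℓ → ℕ}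

theorem multiSpechtRep_character (p : ∀ i, Nat.Partition (a i))
    (σ : ∀ i, Equiv.Perm (Fin (a i))) :
    (multiSpechtRep p).character σ = ∏ i, (spechtRep (p i)).character (σ i) :=
  trace_piTensorProduct_map _

/-- Both characters are products over the factors, so the sum over the product group is the product
of the orthogonality sums. -/
theorem sum_multiSpechtRep_character (p q : ∀ i, Nat.Partition (a i)) :
    ∑ σ, (multiSpechtRep p).character σ * (multiSpechtRep q).character σ⁻¹ =
      if p = q then (Nat.card (∀ i, Equiv.Perm (Fin (a i))) : ℂ) else 0 := by
  classical
  have h : ∀ i, ∑ g, (spechtRep (p i)).character g * (spechtRep (q i)).character g⁻¹ =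
      if p i = q i then (Nat.card (Equiv.Perm (Fin (a i))) : ℂ) else 0 := fun i => by
    have h0 := natCard_ne_zero_complex (Equiv.Perm (Fin (a i)))
    let _ := invertibleOfNonzero h0
    have h := Representation.char_orthonormal (spechtRep (p i)) (spechtRep (q i))
    rw [inv_mul_eq_iff_eq_mul₀ h0] at h
    rw [h]
    by_cases hij : p i = q i
    · rw [hij, if_pos ⟨Representation.Equiv.refl _⟩, if_pos rfl, mul_one]
    · rw [if_neg fun h' => hij (eq_of_spechtRep_equiv h'.some).symm, if_neg hij, mul_zero]
  simp only [multiSpechtRep_character, ← Finset.prod_mul_distrib, Pi.inv_apply]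
  rw [← Fintype.piFinset_univ, ← Finset.prod_univ_sum (fun _ => Finset.univ)
    (fun i g => (spechtRep (p i)).character g * (spechtRep (q i)).character g⁻¹)]
  simp only [h]
  split_ifs with hpq
  · simp [hpq]
  · obtain ⟨i, hi⟩ := Function.ne_iff.1 hpq
    exact Finset.prod_eq_zero (Finset.mem_univ i) (if_neg hi)

instance multiSpechtRep_isIrreducible (p : ∀ i, Nat.Partition (a i)) :
    (multiSpechtRep p).IsIrreducible :=
  isIrreducible_of_char_norm_one _ ((sum_multiSpechtRep_character p p).trans (if_pos rfl))

theorem eq_of_multiSpechtRep_equiv (p q : ∀ i, Nat.Partition (a i))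
    (φ : (multiSpechtRep p).Equiv (multiSpechtRep q)) : p = q := by
  have h := sum_multiSpechtRep_character p q
  rw [← Representation.char_iso φ, sum_multiSpechtRep_character, if_pos rfl] at h
  by_contra hpq
  rw [if_neg hpq] at h
  exact natCard_ne_zero_complex _ h

instance (p : ∀ i, Nat.Partition (a i)) : Nontrivial (MultiSpecht p) :=
  nontrivial_of_isIrreducible (multiSpechtRep p)

/-- Every non-zero finite dimensional representation of a Young subgroup receives a non-zero map
from an outer tensor product of Specht modules. -/
theorem exists_multiSpechtRep_hom {V : Type*} [AddCommGroup V] [Module ℂ V]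
    [FiniteDimensional ℂ V] [Nontrivial V]
    (σ : Representation ℂ (∀ i, Equiv.Perm (Fin (a i))) V) :
    ∃ p, ∃ φ : (multiSpechtRep p).IntertwiningMap σ, φ ≠ 0 := by
  -- The separating map takes cycle types in each factor; the cast replaces `Fintype.card (Fin (a
  -- i))` by `a i`.
  refine exists_intertwiningMap_ne_zero (I := ∀ i, Nat.Partition (a i))
    (fun g i => Equiv.cast (congrArg Nat.Partition (Fintype.card_fin (a i))) (g i).partition)
    (fun g h hgh => ?_) multiSpechtRep (fun p => inferInstance)
    (fun p q h => eq_of_multiSpechtRep_equiv p q h.some) σ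
  have hi : ∀ i, ∃ c, c * g i * c⁻¹ = h i := fun i =>
    isConj_iff.1 (Equiv.Perm.partition_eq_of_isConj.2 ((Equiv.cast _).injective (congrFun hgh i)))
  choose c hc using hi
  exact isConj_iff.2 ⟨c, funext hc⟩

end MultiSpecht

/-! ## Morphisms between colorings of the same type -/

section Young

variable {ℓ d : ℕ} {a : Comp ℓ d}

theorem autToYoung_injective : Function.Injective (autToYoung (a := a)) := by
  intro π ρ h
  apply Subtype.ext
  ext1 x
  have hi := congrFun h (canon a x)
  have h1 := Equiv.congr_fun hi ((fibreIso (type_canon a) _).symm ⟨x, rfl⟩)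
  change (fibreIso (type_canon a) _).symm (fibreMap π _ (fibreIso (type_canon a) _
    ((fibreIso (type_canon a) _).symm ⟨x, rfl⟩))) = (fibreIso (type_canon a) _).symm
      (fibreMap ρ _ (fibreIso (type_canon a) _ ((fibreIso (type_canon a) _).symm ⟨x, rfl⟩))) at h1
  rw [OrderIso.apply_symm_apply] at h1
  exact congrArg Subtype.val ((fibreIso (type_canon a) _).symm.injective h1)

/-- The morphism assembled from bijections between the sets of points of each color. -/
def homOfFibres {f g : Coloring ℓ d} (e : ∀ i, {x // f x = i} ≃ {x // g x = i}) : f ⟶ g :=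
  ⟨(Equiv.sigmaFiberEquiv f).symm.trans
      ((Equiv.sigmaCongrRight e).trans (Equiv.sigmaFiberEquiv g)), fun x => (e (f x) ⟨x, rfl⟩).2⟩

theorem fibreMap_homOfFibres {f g : Coloring ℓ d} (e : ∀ i, {x // f x = i} ≃ {x // g x = i})
    (i : Fin ℓ) : fibreMap (homOfFibres e) i = e i := by
  ext ⟨x, rfl⟩
  rfl

theorem autToYoung_surjective : Function.Surjective (autToYoung (a := a)) := by
  intro s
  refine ⟨homOfFibres fun i => ((fibreIso (type_canon a) i).symm.toEquiv.trans (s i)).trans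
    (fibreIso (type_canon a) i).toEquiv, ?_⟩
  funext i
  rw [autToYoung, fibreMap_homOfFibres]
  ext1 x
  simp

theorem toYoung_bijective {f g : Coloring ℓ d} (hf : type f = a) (hg : type g = a) :
    Function.Bijective (toYoung hf hg) := by
  constructor
  · intro π ρ h
    have h1 := autToYoung_injective h
    have h2 := congrArg (fun x => ordIso hf (type_canon a) ≫ x ≫ ordIso (type_canon a) hg) h1
    simp only [Category.assoc, ordIso_trans, ordIso_refl, Category.comp_id] at h2
    simpa only [← Category.assoc, ordIso_trans, ordIso_refl, Category.id_comp] using h2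
  · intro s
    obtain ⟨π, rfl⟩ := autToYoung_surjective s
    refine ⟨ordIso hf (type_canon a) ≫ π ≫ ordIso (type_canon a) hg, ?_⟩
    rw [toYoung]
    congr 1
    simp only [Category.assoc, ordIso_trans, ordIso_refl, Category.comp_id]
    rw [← Category.assoc, ordIso_trans, ordIso_refl, Category.id_comp]

/-- The morphisms between two colorings of type `a` correspond to the elements of the Young
subgroup. -/
def ofYoung {f g : Coloring ℓ d} (hf : type f = a) (hg : type g = a)
    (s : ∀ i, Equiv.Perm (Fin (a.1 i))) : f ⟶ g :=
  (Equiv.ofBijective _ (toYoung_bijective hf hg)).symm s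

theorem toYoung_ofYoung {f g : Coloring ℓ d} (hf : type f = a) (hg : type g = a)
    (s : ∀ i, Equiv.Perm (Fin (a.1 i))) : toYoung hf hg (ofYoung hf hg s) = s :=
  (Equiv.ofBijective _ (toYoung_bijective hf hg)).apply_symm_apply s

theorem ofYoung_one {f : Coloring ℓ d} (hf : type f = a) : ofYoung hf hf 1 = 𝟙 f :=
  (toYoung_bijective hf hf).1 (by rw [toYoung_ofYoung, toYoung_id])

theorem ofYoung_comp {f g h : Coloring ℓ d} (hf : type f = a) (hg : type g = a)
    (hh : type h = a) (s t : ∀ i, Equiv.Perm (Fin (a.1 i))) :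
    ofYoung hf hg s ≫ ofYoung hg hh t = ofYoung hf hh (t * s) :=
  (toYoung_bijective hf hh).1 (by
    rw [toYoung_comp hf hg hh, toYoung_ofYoung, toYoung_ofYoung, toYoung_ofYoung])

theorem ofYoung_toYoung {f g : Coloring ℓ d} (hf : type f = a) (hg : type g = a) (π : f ⟶ g) :
    ofYoung hf hg (toYoung hf hg π) = π :=
  (Equiv.ofBijective _ (toYoung_bijective hf hg)).symm_apply_apply π

end Young

/-! ## The values of the modules `L_p` -/

theorem linExt_act {ℓ d : ℕ} (F : Coloring ℓ d ⥤ FGModuleCat.{0} ℂ) {f g : Coloring ℓ d}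
    (π : f ⟶ g) : (linExt F).act π = (F.map π).hom.hom :=
  congrArg (fun u : F.obj f ⟶ F.obj g => u.hom.hom)
    ((linMap_single F π 1).trans (one_smul ℂ (F.map π)))

section LValues

variable {ℓ d : ℕ}

/-- The value of `L_p` at a coloring of the type of `p`. -/
def LEquiv (p : MultiPartition ℓ d) {f : Coloring ℓ d} (hf : type f = p.1) :
    MultiSpecht p.2 ≃ₗ[ℂ] (L p).val f :=
  (LinearEquiv.ofTop (LSub p f) (LSub_eq_top hf)).symm

theorem L_act_LEquiv (p : MultiPartition ℓ d) {f g : Coloring ℓ d} (hf : type f = p.1)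
    (hg : type g = p.1) (π : f ⟶ g) (v : MultiSpecht p.2) :
    (L p).act π (LEquiv p hf v) = LEquiv p hg (multiSpechtRep p.2 (toYoung hf hg π) v) := by
  rw [show (L p).act π = ((LFunctor p).map π).hom.hom from linExt_act _ π]
  apply Subtype.ext
  change LAct p π v = multiSpechtRep p.2 (toYoung hf hg π) v
  rw [LAct, dif_pos ⟨hf, hg⟩]

theorem L_subsingleton (p : MultiPartition ℓ d) {f : Coloring ℓ d} (hf : type f ≠ p.1) :
    Subsingleton ((L p).val f) := by
  have h : Subsingleton (LSub p f) := by
    rw [LSub_eq_bot hf]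
    infer_instance
  exact h

theorem eq_top_of_isIrreducible {G V : Type*} [Group G] [AddCommGroup V] [Module ℂ V]
    (ρ : Representation ℂ G V) [hρ : ρ.IsIrreducible] (U : Submodule ℂ V)
    (hU : ∀ g, ∀ v ∈ U, ρ g v ∈ U) (hne : U ≠ ⊥) : U = ⊤ := by
  rcases hρ.eq_bot_or_eq_top ⟨U, hU⟩ with h | h
  · exact absurd (congrArg Subrepresentation.toSubmodule h) hne
  · exact congrArg Subrepresentation.toSubmodule h

/-- An invariant family of subspaces of the values of `L_p` is zero or everything. -/
theorem L_submodule_eq_top (p : MultiPartition ℓ d) (W : ∀ f, Submodule ℂ ((L p).val f))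
    (hW : ∀ {f g : Coloring ℓ d} (π : f ⟶ g), ∀ v ∈ W f, (L p).act π v ∈ W g)
    (hne : ∃ f, W f ≠ ⊥) (g : Coloring ℓ d) : W g = ⊤ := by
  obtain ⟨f, hne⟩ := hne
  have hf : type f = p.1 := by
    by_contra hf
    have := L_subsingleton p hf
    exact hne (Subsingleton.elim _ _)
  by_cases hg : type g = p.1
  · have htop : (W f).comap (LEquiv p hf).toLinearMap = ⊤ := by
      refine eq_top_of_isIrreducible (multiSpechtRep p.2) _ (fun s v hv => ?_) fun h => hne ?_
      · have h := hW (ofYoung hf hf s) _ hv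
        rw [LinearEquiv.coe_coe, L_act_LEquiv p hf hf, toYoung_ofYoung] at h
        exact h
      · rw [Submodule.eq_bot_iff] at h ⊢
        intro x hx
        have := h ((LEquiv p hf).symm x) (by simpa using hx)
        simpa using this
    refine Submodule.eq_top_iff'.2 fun x => ?_
    obtain ⟨v, rfl⟩ := (LEquiv p hg).surjective x
    have hv : v ∈ (W f).comap (LEquiv p hf).toLinearMap := htop ▸ Submodule.mem_top
    -- In the coordinates `LEquiv` this morphism acts as the identity, so it carries all of `L_p(f)`
    -- onto all of `L_p(g)`.
    have h := hW (ofYoung hf hg 1) _ hv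
    rw [LinearEquiv.coe_coe, L_act_LEquiv p hf hg, toYoung_ofYoung, map_one] at h
    exact h
  · have := L_subsingleton p hg
    exact Subsingleton.elim _ _

/-- A nonzero component forces `f` to have both types. It commutes with the automorphisms of `f`, so
Schur's lemma makes it an isomorphism of Young subgroup representations. -/
theorem L_eq_of_natural (p q : MultiPartition ℓ d)
    (η : ∀ f : Coloring ℓ d, (L p).val f →ₗ[ℂ] (L q).val f)
    (hη : ∀ {f g : Coloring ℓ d} (π : f ⟶ g) (v : (L p).val f),
      η g ((L p).act π v) = (L q).act π (η f v))
    (hne : ∃ f, η f ≠ 0) : p = q := by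
  obtain ⟨f, hne⟩ := hne
  have hp : type f = p.1 := by
    by_contra hf
    have := L_subsingleton p hf
    exact hne (Subsingleton.elim _ _)
  have hq : type f = q.1 := by
    by_contra hf
    have := L_subsingleton q hf
    exact hne (LinearMap.ext fun v => Subsingleton.elim _ _)
  obtain ⟨a, p⟩ := p
  obtain ⟨b, q⟩ := q
  obtain rfl : a = b := hp.symm.trans hq
  let φ : MultiSpecht p →ₗ[ℂ] MultiSpecht q :=
    (LEquiv ⟨a, q⟩ hq).symm.toLinearMap ∘ₗ η f ∘ₗ (LEquiv ⟨a, p⟩ hp).toLinearMap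
  have hφ : ∀ s v, φ (multiSpechtRep p s v) = multiSpechtRep q s (φ v) := fun s v => by
    have h1 := L_act_LEquiv ⟨a, p⟩ hp hp (ofYoung hp hp s) v
    rw [toYoung_ofYoung] at h1
    have h2 := L_act_LEquiv ⟨a, q⟩ hq hq (ofYoung hp hp s) (φ v)
    rw [toYoung_ofYoung] at h2
    apply (LEquiv ⟨a, q⟩ hq).injective
    rw [← h2]
    simp only [φ, LinearMap.comp_apply, LinearEquiv.coe_coe, LinearEquiv.apply_symm_apply]
    rw [← h1, hη]
  let Φ := φ.intertwiningMap_of_isIntertwiningMap (multiSpechtRep p) (multiSpechtRep q) hφ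
  rcases Representation.IsIrreducible.bijective_or_eq_zero Φ with h | h
  · rw [eq_of_multiSpechtRep_equiv p q (Φ.ofBijective h)]
  · exfalso
    apply hne
    refine LinearMap.ext fun x => ?_
    have hx : φ ((LEquiv ⟨a, p⟩ hp).symm x) = 0 := DFunLike.congr_fun h _
    simpa [φ] using hx

/-- Every non-zero family of finite dimensional spaces on which the groupoid acts receives a
non-zero map from some `L_p`. -/
theorem exists_natural_from_L {V : Coloring ℓ d → Type*} [∀ f, AddCommGroup (V f)]
    [∀ f, Module ℂ (V f)] [∀ f, FiniteDimensional ℂ (V f)]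
    (act : ∀ {f g : Coloring ℓ d}, (f ⟶ g) → V f →ₗ[ℂ] V g)
    (act_id : ∀ f v, act (𝟙 f) v = v)
    (act_comp : ∀ {f g h : Coloring ℓ d} (π : f ⟶ g) (ρ : g ⟶ h) (v : V f),
      act (π ≫ ρ) v = act ρ (act π v))
    (hV : ∃ f, Nontrivial (V f)) :
    ∃ (p : MultiPartition ℓ d) (η : ∀ f : Coloring ℓ d, (L p).val f →ₗ[ℂ] V f),
      (∀ {f g : Coloring ℓ d} (π : f ⟶ g) (v : (L p).val f),
        η g ((L p).act π v) = act π (η f v)) ∧ ∃ f, η f ≠ 0 := by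
  classical
  obtain ⟨f₀, hV⟩ := hV
  obtain ⟨a, h₀⟩ : ∃ a, type f₀ = a := ⟨_, rfl⟩
  let σ : Representation ℂ (∀ i, Equiv.Perm (Fin (a.1 i))) (V f₀) :=
    { toFun := fun s => act (ofYoung h₀ h₀ s)
      map_one' := LinearMap.ext fun v => by rw [ofYoung_one, act_id]; rfl
      map_mul' := fun s t => LinearMap.ext fun v => by
        rw [← ofYoung_comp h₀ h₀ h₀, act_comp]
        rfl }
  obtain ⟨p, φ, hφ⟩ := exists_multiSpechtRep_hom σ
  -- The map `φ` at `f₀` is carried to the other colorings of type `a` along the morphisms with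
  -- trivial Young element.
  let η : ∀ f : Coloring ℓ d, (L ⟨a, p⟩).val f →ₗ[ℂ] V f := fun f =>
    if hf : type f = a then act (ofYoung h₀ hf 1) ∘ₗ φ.toLinearMap ∘ₗ
      (LEquiv ⟨a, p⟩ hf).symm.toLinearMap else 0
  have hη : ∀ {f : Coloring ℓ d} (hf : type f = a) (v : MultiSpecht p),
      η f (LEquiv ⟨a, p⟩ hf v) = act (ofYoung h₀ hf 1) (φ v) := fun hf v => by
    simp only [η, dif_pos hf, LinearMap.comp_apply, LinearEquiv.coe_coe,
      LinearEquiv.symm_apply_apply]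
    rfl
  refine ⟨⟨a, p⟩, η, fun {f g} π x => ?_, f₀, fun h => hφ ?_⟩
  · by_cases hf : type f = a
    · have hg : type g = a := (type_eq_of_hom π).symm.trans hf
      obtain ⟨v, rfl⟩ := (LEquiv ⟨a, p⟩ hf).surjective x
      rw [L_act_LEquiv ⟨a, p⟩ hf hg, hη, hη, φ.isIntertwining]
      change act _ (act (ofYoung h₀ h₀ _) (φ v)) = _
      rw [← act_comp, ← act_comp, ofYoung_comp, ← ofYoung_toYoung hf hg π, ofYoung_comp,
        ofYoung_toYoung, one_mul, mul_one]
    · have := L_subsingleton ⟨a, p⟩ hf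
      rw [Subsingleton.elim x 0, map_zero, map_zero, map_zero, map_zero]
  · refine DFunLike.ext _ _ fun v => ?_
    have h1 := hη h₀ v
    rw [h, ofYoung_one, act_id] at h1
    exact h1.symm

end LValues

/-! ## Simple modules over the linearized groupoid -/

section GMod

variable {ℓ d : ℕ}

/-- The component of a morphism of modules. -/
def GMod.app {M N : GMod ℓ d} (φ : M ⟶ N) (f : Coloring ℓ d) : M.val f →ₗ[ℂ] N.val f :=
  (φ.hom.app (Free.of ℂ f)).hom.hom

theorem GMod.app_natural {M N : GMod ℓ d} (φ : M ⟶ N) {f g : Coloring ℓ d} (π : f ⟶ g)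
    (v : M.val f) : app φ g (M.act π v) = N.act π (app φ f v) :=
  LinearMap.congr_fun (congrArg (fun u => u.hom.hom)
    (φ.hom.naturality ((Free.embedding ℂ (Coloring ℓ d)).map π))) v

theorem GMod.hom_ext {M N : GMod ℓ d} {φ ψ : M ⟶ N} (h : ∀ f, app φ f = app ψ f) : φ = ψ := by
  apply ObjectProperty.hom_ext
  apply NatTrans.ext
  funext f
  exact FGModuleCat.hom_ext (h f)

theorem free_hom_induction {f g : Coloring ℓ d}
    {P : (Free.of ℂ f ⟶ Free.of ℂ g) → Prop} (zero : P 0)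
    (add : ∀ u v, P u → P v → P (u + v))
    (smul : ∀ (r : ℂ) (π : f ⟶ g),
      P (r • show Free.of ℂ f ⟶ Free.of ℂ g from (Free.embedding ℂ (Coloring ℓ d)).map π))
    (u : Free.of ℂ f ⟶ Free.of ℂ g) : P u := by
  refine Finsupp.induction_linear (motive := P) u zero (fun u v => add u v) fun π r => ?_
  have e : r • (Free.embedding ℂ (Coloring ℓ d)).map (show f ⟶ g from π) =
      (show Free.of ℂ f ⟶ Free.of ℂ g from Finsupp.single π r) :=
    (Finsupp.smul_single r π (1 : ℂ)).trans (congrArg (Finsupp.single π) (mul_one r))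
  exact Eq.subst (motive := P) e (smul r π)

/-- Both functors are linear and every morphism of the linearization is a combination of groupoid
morphisms, so naturality on the latter suffices. -/
theorem GMod.naturality_of_act {M N : GMod ℓ d} (η : ∀ f : Coloring ℓ d, M.val f →ₗ[ℂ] N.val f)
    (hη : ∀ {f g : Coloring ℓ d} (π : f ⟶ g) (v : M.val f),
      η g (M.act π v) = N.act π (η f v)) {f g : Coloring ℓ d} (u : Free.of ℂ f ⟶ Free.of ℂ g) :
    M.obj.map u ≫ FGModuleCat.ofHom (η g) = FGModuleCat.ofHom (η f) ≫ N.obj.map u := by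
  have := M.property.1
  have := M.property.2
  have := N.property.1
  have := N.property.2
  induction u using free_hom_induction with
  | zero => rw [Functor.map_zero, Functor.map_zero, Limits.zero_comp, Limits.comp_zero]
  | add u v hu hv =>
    rw [Functor.map_add, Functor.map_add, Preadditive.add_comp, Preadditive.comp_add]
    exact congrArg₂ (· + ·) hu hv
  | smul r π =>
    rw [Functor.map_smul, Functor.map_smul, Linear.smul_comp, Linear.comp_smul]
    congr 1
    apply FGModuleCat.hom_ext
    exact LinearMap.ext fun v => hη π v

/-- A natural family of linear maps is a morphism of modules. -/
def GMod.homMk {M N : GMod ℓ d} (η : ∀ f : Coloring ℓ d, M.val f →ₗ[ℂ] N.val f)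
    (hη : ∀ {f g : Coloring ℓ d} (π : f ⟶ g) (v : M.val f),
      η g (M.act π v) = N.act π (η f v)) : M ⟶ N :=
  ObjectProperty.homMk
    { app := fun f => FGModuleCat.ofHom (η f)
      naturality := fun _ _ u => naturality_of_act η hη u }

theorem GMod.app_homMk {M N : GMod ℓ d} (η : ∀ f : Coloring ℓ d, M.val f →ₗ[ℂ] N.val f)
    (hη : ∀ {f g : Coloring ℓ d} (π : f ⟶ g) (v : M.val f),
      η g (M.act π v) = N.act π (η f v)) (f : Coloring ℓ d) : app (homMk η hη) f = η f := rfl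

theorem GMod.app_comp {M N P : GMod ℓ d} (φ : M ⟶ N) (ψ : N ⟶ P) (f : Coloring ℓ d)
    (v : M.val f) : app (φ ≫ ψ) f v = app ψ f (app φ f v) := rfl

theorem GMod.app_id (M : GMod ℓ d) (f : Coloring ℓ d) (v : M.val f) : app (𝟙 M) f v = v := rfl

theorem GMod.app_zero (M N : GMod ℓ d) (f : Coloring ℓ d) : app (0 : M ⟶ N) f = 0 := rfl

theorem GMod.isIso_of_bijective {M N : GMod ℓ d} (φ : M ⟶ N)
    (h : ∀ f, Function.Bijective (app φ f)) : IsIso φ := by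
  let e := fun f => LinearEquiv.ofBijective (app φ f) (h f)
  have he : ∀ f v, e f v = app φ f v := fun f v => rfl
  let ψ : N ⟶ M := homMk (fun f => (e f).symm.toLinearMap) fun {f g} π v => by
    apply (e g).injective
    rw [LinearEquiv.coe_coe, LinearEquiv.coe_coe, LinearEquiv.apply_symm_apply, he, app_natural,
      ← he, LinearEquiv.apply_symm_apply]
  refine ⟨ψ, hom_ext fun f => LinearMap.ext fun v => ?_, hom_ext fun f => LinearMap.ext fun v => ?_⟩
  · exact (e f).symm_apply_apply v
  · exact (e f).apply_symm_apply v

/-- The kernel of a morphism of modules. -/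
def GMod.ker {M N : GMod ℓ d} (φ : M ⟶ N) : GMod ℓ d :=
  linExt
    { obj := fun f => FGModuleCat.of ℂ (LinearMap.ker (app φ f))
      map := fun {f g} π => FGModuleCat.ofHom ((M.act π).restrict fun v hv => by
        rw [LinearMap.mem_ker] at hv ⊢
        rw [app_natural, hv, map_zero])
      map_id := fun f => by
        apply FGModuleCat.hom_ext
        ext v
        exact act_id M f v.1
      map_comp := fun π ρ => by
        apply FGModuleCat.hom_ext
        ext v
        exact act_comp M π ρ v.1 }

/-- The inclusion of the kernel of a morphism of modules. -/
def GMod.kerι {M N : GMod ℓ d} (φ : M ⟶ N) : ker φ ⟶ M :=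
  homMk (fun f => (LinearMap.ker (app φ f)).subtype) fun {f g} π v => by
    rw [show (ker φ).act π = _ from linExt_act _ π]
    rfl

/-- The pointwise kernel is itself a module, and cancelling `φ` shows that its inclusion is zero. -/
theorem GMod.injective_of_mono {M N : GMod ℓ d} (φ : M ⟶ N) [Mono φ] (f : Coloring ℓ d) :
    Function.Injective (app φ f) := by
  have h0 : kerι φ ≫ φ = 0 ≫ φ := hom_ext fun f => LinearMap.ext fun v => by
    rw [Limits.zero_comp, app_zero]
    exact v.2
  have h1 := (cancel_mono φ).1 h0
  rw [← LinearMap.ker_eq_bot, Submodule.eq_bot_iff]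
  intro v hv
  exact LinearMap.congr_fun (congrArg (fun ψ => app ψ f) h1) ⟨v, hv⟩

theorem GMod.mono_of_injective {M N : GMod ℓ d} (φ : M ⟶ N)
    (h : ∀ f, Function.Injective (app φ f)) : Mono φ :=
  ⟨fun u v huv => hom_ext fun f => LinearMap.ext fun x => h f (by
    rw [← app_comp, huv, app_comp])⟩

theorem nontrivial_L_val (p : MultiPartition ℓ d) : Nontrivial ((L p).val (canon p.1)) :=
  (LEquiv p (type_canon p.1)).symm.toEquiv.nontrivial

theorem L_simple (p : MultiPartition ℓ d) : Simple (L p) := by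
  refine ⟨fun {M} φ hφ => ⟨fun hiso h0 => ?_, fun h0 => ?_⟩⟩
  · have := nontrivial_L_val p
    obtain ⟨v, hv⟩ := exists_ne (0 : (L p).val (canon p.1))
    apply hv
    have hφ0 : GMod.app φ (canon p.1) = 0 := by
      rw [h0, GMod.app_zero]
    rw [← GMod.app_id (L p) _ v, ← IsIso.inv_hom_id φ, GMod.app_comp, hφ0, LinearMap.zero_apply]
  · have hinj := GMod.injective_of_mono φ
    refine GMod.isIso_of_bijective φ fun f => ⟨hinj f, ?_⟩
    rw [← LinearMap.range_eq_top]
    refine L_submodule_eq_top p (fun f => LinearMap.range (GMod.app φ f)) ?_ ?_ f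
    · rintro f g π _ ⟨v, rfl⟩
      exact ⟨M.act π v, GMod.app_natural φ π v⟩
    · by_contra! h
      exact h0 (GMod.hom_ext fun f => LinearMap.range_eq_bot.1 (h f))

theorem eq_of_L_iso (p q : MultiPartition ℓ d) (e : L p ≅ L q) : p = q := by
  refine L_eq_of_natural p q (GMod.app e.hom) (GMod.app_natural e.hom) ?_
  by_contra! h
  have := L_simple p
  apply id_nonzero (L p)
  rw [← e.hom_inv_id, show e.hom = 0 from GMod.hom_ext h, Limits.zero_comp]

theorem exists_iso_L (M : GMod ℓ d) [Simple M] : ∃ p : MultiPartition ℓ d, Nonempty (M ≅ L p) := by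
  have hV : ∃ f, Nontrivial (M.val f) := by
    by_contra! h
    refine id_nonzero M (GMod.hom_ext fun f => LinearMap.ext fun v => ?_)
    exact (h f).elim _ _
  obtain ⟨p, η, hη, f, hf⟩ := exists_natural_from_L M.act (act_id M) (act_comp M) hV
  let φ : L p ⟶ M := GMod.homMk η hη
  have hinj : ∀ f, Function.Injective (GMod.app φ f) := fun g => by
    by_contra hg
    -- If some component had a kernel, the kernels would be everything, against `η f ≠ 0`.
    have htop := L_submodule_eq_top p (fun f => LinearMap.ker (η f))
      (fun π v hv => by
        rw [LinearMap.mem_ker] at hv ⊢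
        rw [hη, hv, map_zero]) ⟨g, fun h => hg (LinearMap.ker_eq_bot.1 h)⟩ f
    exact hf (LinearMap.ker_eq_top.1 htop)
  have := GMod.mono_of_injective φ hinj
  have := isIso_of_mono_of_nonzero (f := φ) fun h => hf (by
    rw [← GMod.app_homMk η hη f, show GMod.homMk η hη = 0 from h, GMod.app_zero])
  exact ⟨p, ⟨(asIso φ).symm⟩⟩

end GMod

/-! ## Weight spaces of representations of the generalized symmetric group -/

section Weights

variable {ℓ d : ℕ}

theorem Coloring.ext' {f g : Coloring ℓ d} (h : ∀ x, f x = g x) : f = g := by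
  obtain ⟨f⟩ := f
  obtain ⟨g⟩ := g
  exact congrArg Coloring.mk (funext h)

/-- Colorings are maps. -/
def coloringEquiv (ℓ d : ℕ) : Coloring ℓ d ≃ (Fin d → Fin ℓ) where
  toFun f := f
  invFun f := ⟨f⟩
  left_inv _ := rfl
  right_inv _ := rfl

instance : Fintype (Coloring ℓ d) := Fintype.ofEquiv _ (coloringEquiv ℓ d).symm

instance : DecidableEq (Coloring ℓ d) := (coloringEquiv ℓ d).decidableEq

/-- The weight of a coloring as a character of the diagonal subgroup. -/
def weightHom (f : Coloring ℓ d) : (Fin d → rootsOfUnity ℓ ℂ) →* ℂ where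
  toFun z := weight z f
  map_one' := weight_one f
  map_mul' z w := by simp [weight, mul_pow, Finset.prod_mul_distrib]

theorem weight_mul' (z w : Fin d → rootsOfUnity ℓ ℂ) (f : Coloring ℓ d) :
    weight (z * w) f = weight z f * weight w f := map_mul (weightHom f) z w

theorem weight_inv_mul_self (z : Fin d → rootsOfUnity ℓ ℂ) (f : Coloring ℓ d) :
    weight z⁻¹ f * weight z f = 1 := by
  rw [← weight_mul', inv_mul_cancel, weight_one]

variable {V : Type*} [AddCommGroup V] [Module ℂ V] (ρ : Representation ℂ (Wreath ℓ d) V)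

/-- The subspace on which diagonal matrices act by the weight of a coloring. -/
def weightSpace (f : Coloring ℓ d) : Submodule ℂ V where
  carrier := {v | ∀ z, ρ (SemidirectProduct.inl z) v = weight z f • v}
  add_mem' hu hv z := by rw [map_add, hu z, hv z, smul_add]
  zero_mem' z := by rw [map_zero, smul_zero]
  smul_mem' c v hv z := by rw [map_smul, hv z, smul_comm]

variable [NeZero ℓ]

instance : Fintype (rootsOfUnity ℓ ℂ) := Fintype.ofFinite _

/-- A primitive root of unity in position `j` detects the color of `j`: once the extra factor from
the shift by one is cancelled, the exponents are less than `ℓ`. -/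
theorem eq_of_weight_eq {f g : Coloring ℓ d} (h : ∀ z, weight z f = weight z g) : f = g := by
  refine Coloring.ext' fun j => ?_
  have hζ := Complex.isPrimitiveRoot_exp ℓ (NeZero.ne ℓ)
  let ζ : rootsOfUnity ℓ ℂ := hζ.toRootsOfUnity
  have hw : ∀ f : Coloring ℓ d, weight (Pi.mulSingle j ζ) f =
      Complex.exp (2 * Real.pi * Complex.I / ℓ) ^ ((f j : ℕ) + 1) := fun f => by
    rw [weight, Finset.prod_eq_single j]
    · rw [Pi.mulSingle_eq_same]
      rfl
    · intro i _ hi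
      rw [Pi.mulSingle_eq_of_ne hi]
      simp
    · simp
  have h1 := h (Pi.mulSingle j ζ)
  rw [hw, hw, pow_succ, pow_succ] at h1
  exact Fin.ext (hζ.pow_inj (f j).2 (g j).2 (mul_right_cancel₀ (Complex.exp_ne_zero _) h1))

theorem sum_weight_inv_mul_weight (f g : Coloring ℓ d) :
    ∑ z, weight z⁻¹ f * weight z g =
      if f = g then (Fintype.card (Fin d → rootsOfUnity ℓ ℂ) : ℂ) else 0 := by
  classical
  let χ : (Fin d → rootsOfUnity ℓ ℂ) →* ℂ :=
    { toFun := fun z => weight z⁻¹ f * weight z g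
      map_one' := by rw [inv_one, weight_one, weight_one, one_mul]
      map_mul' := fun z w => by
        rw [mul_inv, weight_mul', weight_mul']
        ring }
  have h := sum_hom_units χ
  by_cases hfg : f = g
  · subst hfg
    simp [weight_inv_mul_self]
  · rw [if_neg hfg]
    refine sum_hom_units_eq_zero χ fun h1 => hfg (eq_of_weight_eq fun z => ?_)
    have hz : weight z⁻¹ f * weight z g = 1 := DFunLike.congr_fun h1 z
    have hz' := weight_inv_mul_self z f
    exact mul_left_cancel₀ (left_ne_zero_of_mul_eq_one hz) (hz'.trans hz.symm)

/-- The sum factors into one geometric sum per point, which vanishes wherever `z j ≠ 1`. This second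
orthogonality relation makes the weight projections add up to the identity. -/
theorem sum_weight (z : Fin d → rootsOfUnity ℓ ℂ) :
    ∑ f : Coloring ℓ d, weight z f =
      if z = 1 then (Fintype.card (Fin d → rootsOfUnity ℓ ℂ) : ℂ) else 0 := by
  have h1 : ∑ f : Coloring ℓ d, weight z f =
      ∏ j, ∑ c : Fin ℓ, (((z j : ℂˣ) : ℂ) ^ ((c : ℕ) + 1)) := by
    rw [Finset.prod_univ_sum, Fintype.piFinset_univ]
    exact Fintype.sum_equiv (coloringEquiv ℓ d) _ _ fun f => rfl
  rw [h1]
  split_ifs with hz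
  · rw [Fintype.card_fun, ← Nat.card_eq_fintype_card (α := rootsOfUnity ℓ ℂ),
      Complex.card_rootsOfUnity]
    simp [hz]
  · obtain ⟨j, hj⟩ := Function.ne_iff.1 hz
    refine Finset.prod_eq_zero (Finset.mem_univ j) ?_
    have hne : ((z j : ℂˣ) : ℂ) - 1 ≠ 0 := fun h => hj (by
      apply Subtype.ext
      apply Units.ext
      exact sub_eq_zero.1 h)
    have hpow : ((z j : ℂˣ) : ℂ) ^ ℓ = 1 := by
      rw [← Units.val_pow_eq_pow_val, (mem_rootsOfUnity ℓ (z j : ℂˣ)).1 (z j).2, Units.val_one]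
    simp only [pow_succ]
    rw [← Finset.sum_mul, Fin.sum_univ_eq_sum_range (fun c => ((z j : ℂˣ) : ℂ) ^ c),
      (mul_eq_zero.1 ((geom_sum_mul ((z j : ℂˣ) : ℂ) ℓ).trans (by rw [hpow, sub_self]))).resolve_right
        hne, zero_mul]

/-- The projection to a weight space. -/
def weightProj (f : Coloring ℓ d) : V →ₗ[ℂ] V :=
  (Fintype.card (Fin d → rootsOfUnity ℓ ℂ) : ℂ)⁻¹ •
    ∑ z, weight z⁻¹ f • ρ (SemidirectProduct.inl z)

theorem weightProj_apply (f : Coloring ℓ d) (v : V) :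
    weightProj ρ f v = (Fintype.card (Fin d → rootsOfUnity ℓ ℂ) : ℂ)⁻¹ •
      ∑ z, weight z⁻¹ f • ρ (SemidirectProduct.inl z) v := by
  simp [weightProj]

theorem card_diagonal_ne_zero : (Fintype.card (Fin d → rootsOfUnity ℓ ℂ) : ℂ) ≠ 0 :=
  Nat.cast_ne_zero.2 Fintype.card_ne_zero

theorem weightProj_mem (f : Coloring ℓ d) (v : V) : weightProj ρ f v ∈ weightSpace ρ f := by
  intro w
  rw [weightProj_apply, map_smul, map_sum, smul_comm (weight w f),
    Finset.smul_sum (r := weight w f)]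
  congr 1
  refine Fintype.sum_equiv (Equiv.mulLeft w) _ _ fun z => ?_
  rw [map_smul, ← Module.End.mul_apply, ← map_mul, ← map_mul, Equiv.coe_mulLeft, smul_smul,
    mul_inv, weight_mul', ← mul_assoc, mul_comm (weight w f), weight_inv_mul_self, one_mul]

theorem weightProj_of_mem {f g : Coloring ℓ d} {v : V} (hv : v ∈ weightSpace ρ g) :
    weightProj ρ f v = if f = g then v else 0 := by
  rw [weightProj_apply, Finset.sum_congr rfl fun z _ => by rw [hv z, smul_smul],
    ← Finset.sum_smul, sum_weight_inv_mul_weight, smul_smul]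
  split_ifs
  · rw [inv_mul_cancel₀ card_diagonal_ne_zero, one_smul]
  · rw [mul_zero, zero_smul]

theorem sum_weightProj (v : V) : ∑ f, weightProj ρ f v = v := by
  simp only [weightProj_apply]
  rw [← Finset.smul_sum, Finset.sum_comm]
  simp only [← Finset.sum_smul, sum_weight, inv_eq_one]
  simp [smul_smul]

theorem exists_weightSpace_nontrivial [Nontrivial V] : ∃ f, Nontrivial (weightSpace ρ f) := by
  by_contra! h
  obtain ⟨v, hv⟩ := exists_ne (0 : V)
  refine hv ((sum_weightProj ρ v).symm.trans (Finset.sum_eq_zero fun f _ => ?_))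
  exact congrArg Subtype.val
    ((h f).elim (⟨_, weightProj_mem ρ f v⟩ : weightSpace ρ f) 0)

end Weights

/-! ### From groupoid actions to representations of the wreath product and back -/

section Wreath

variable {ℓ d : ℕ} {V : Type*} [AddCommGroup V] [Module ℂ V]
  (ρ : Representation ℂ (Wreath ℓ d) V)

/-- Moving a diagonal matrix past a permutation permutes its entries, which turns the weight of `g`
into the weight of `g ∘ π = f`. -/
theorem map_mem_weightSpace {f g : Coloring ℓ d} (π : f ⟶ g) {v : V} (hv : v ∈ weightSpace ρ f) :
    ρ (SemidirectProduct.inr π.1) v ∈ weightSpace ρ g := by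
  intro z
  obtain ⟨w, rfl⟩ := (mulAutArrow (A := Fin d) (M := rootsOfUnity ℓ ℂ) π.1).surjective z
  have hf : pull π.1 g = f := Coloring.ext' π.2
  have hw := weight_mul 1 w π.1 g
  rw [one_mul, weight_one, one_mul, hf] at hw
  rw [hw, SemidirectProduct.inl_aut, ← Module.End.mul_apply, ← map_mul, mul_assoc, ← map_mul,
    inv_mul_cancel, map_one, mul_one, map_mul, Module.End.mul_apply, hv w, map_smul]

/-- Morphisms of colorings act on weight spaces. -/
def weightSpaceMap {f g : Coloring ℓ d} (π : f ⟶ g) : weightSpace ρ f →ₗ[ℂ] weightSpace ρ g :=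
  (ρ (SemidirectProduct.inr π.1)).restrict fun _ hv => map_mem_weightSpace ρ π hv

section WreathRep

variable (M : GMod ℓ d)

theorem wreathRep_inl (z : Fin d → rootsOfUnity ℓ ℂ) (v : ∀ f, M.val f) (f : Coloring ℓ d) :
    wreathRep M (SemidirectProduct.inl z) v f = weight z f • v f := by
  change weight z f • M.act (𝟙 f) (v f) = _
  rw [act_id]

theorem wreathRep_apply (w : Wreath ℓ d) (v : ∀ f, M.val f) (f : Coloring ℓ d) :
    wreathRep M w v f = weight w.left f • M.act (pullHom w.right f) (v (pull w.right f)) := rfl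

theorem pull_injective (σ : Equiv.Perm (Fin d)) :
    Function.Injective (pull (ℓ := ℓ) σ) := fun f g h => Coloring.ext' fun x => by
  have := congrFun (congrArg Coloring.color h) (σ.symm x)
  simpa [pull] using this

theorem wreathRep_inr_single {f g : Coloring ℓ d} (π : f ⟶ g) (v : M.val f) :
    wreathRep M (SemidirectProduct.inr π.1) (Pi.single f v) = Pi.single g (M.act π v) := by
  obtain ⟨σ, hσ⟩ := π
  obtain rfl : f = pull σ g := (Coloring.ext' hσ).symm
  funext h
  rw [wreathRep_apply]
  change weight 1 h • M.act (pullHom σ h) (Pi.single (pull σ g) v (pull σ h)) = _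
  rw [weight_one, one_smul]
  by_cases hg : h = g
  · subst hg
    rw [Pi.single_eq_same, Pi.single_eq_same]
    rfl
  · rw [Pi.single_eq_of_ne hg, Pi.single_eq_of_ne fun e => hg (pull_injective σ e), map_zero]

theorem single_mem_weightSpace (f : Coloring ℓ d) (v : M.val f) :
    Pi.single f v ∈ weightSpace (wreathRep M) f := by
  intro z
  funext g
  rw [wreathRep_inl]
  by_cases hg : g = f
  · subst hg
    rw [Pi.smul_apply, Pi.single_eq_same]
  · rw [Pi.smul_apply, Pi.single_eq_of_ne hg, smul_zero, smul_zero]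

theorem weightProj_wreathRep [NeZero ℓ] (f : Coloring ℓ d) (v : ∀ f, M.val f) :
    weightProj (wreathRep M) f v = Pi.single f (v f) := by
  have hv : v = ∑ g, Pi.single g (v g) := (Finset.univ_sum_single v).symm
  conv_lhs => rw [hv, map_sum]
  simp only [weightProj_of_mem _ (single_mem_weightSpace M _ _)]
  simp

theorem eq_single_of_mem_weightSpace [NeZero ℓ] {f : Coloring ℓ d} {v : ∀ f, M.val f}
    (hv : v ∈ weightSpace (wreathRep M) f) : v = Pi.single f (v f) := by
  rw [← weightProj_wreathRep, weightProj_of_mem _ hv, if_pos rfl]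

end WreathRep

theorem nontrivial_wreathRep_L (p : MultiPartition ℓ d) :
    Nontrivial (∀ f : Coloring ℓ d, (L p).val f) := by
  have := nontrivial_L_val p
  exact (Pi.single_injective (M := fun f : Coloring ℓ d => (L p).val f)
    (canon p.1)).nontrivial

theorem wreathRep_L_isIrreducible [NeZero ℓ] (p : MultiPartition ℓ d) :
    (wreathRep (L p)).IsIrreducible := by
  have := nontrivial_wreathRep_L p
  refine isIrreducible_of_forall_submodule _ fun U hU hne => ?_
  -- Projection to one summand is an average over the diagonal group, so an invariant subspace
  -- contains the components of its vectors.
  have hproj : ∀ f, ∀ v ∈ U, Pi.single f (v f) ∈ U := fun f v hv => by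
    rw [← weightProj_wreathRep, weightProj_apply]
    exact U.smul_mem _ (U.sum_mem fun z _ => U.smul_mem _ (hU _ _ hv))
  let W : ∀ f, Submodule ℂ ((L p).val f) := fun f =>
    U.comap (LinearMap.single ℂ (fun f : Coloring ℓ d => (L p).val f) f)
  have hW : ∀ f, W f = ⊤ := by
    refine L_submodule_eq_top p W (fun {f g} π v hv => ?_) ?_
    · have h := hU (SemidirectProduct.inr π.1) _ hv
      rw [LinearMap.coe_single, wreathRep_inr_single] at h
      exact h
    · obtain ⟨v, hv, hv0⟩ := (Submodule.ne_bot_iff U).1 hne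
      obtain ⟨f, hf⟩ := Function.ne_iff.1 hv0
      exact ⟨f, (Submodule.ne_bot_iff _).2 ⟨v f, hproj f v hv, hf⟩⟩
  refine Submodule.eq_top_iff'.2 fun v => ?_
  rw [← Finset.univ_sum_single v]
  refine U.sum_mem fun f _ => ?_
  have h : v f ∈ W f := hW f ▸ Submodule.mem_top
  exact h

/-- The summands are the weight spaces, hence preserved by any equivalence, which therefore splits
into a natural family of maps. -/
theorem eq_of_wreathRep_L_equiv [NeZero ℓ] (p q : MultiPartition ℓ d)
    (e : (wreathRep (L p)).Equiv (wreathRep (L q))) : p = q := by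
  let T : (∀ f : Coloring ℓ d, (L p).val f) →ₗ[ℂ] ∀ f : Coloring ℓ d, (L q).val f :=
    e.toIntertwiningMap.toLinearMap
  have hT : ∀ w v, T (wreathRep (L p) w v) = wreathRep (L q) w (T v) :=
    e.toIntertwiningMap.isIntertwining
  have hmem : ∀ f (v : (L p).val f), T (Pi.single f v) ∈ weightSpace (wreathRep (L q)) f :=
    fun f v z => by rw [← hT, single_mem_weightSpace (L p) f v z, map_smul]
  let η : ∀ f : Coloring ℓ d, (L p).val f →ₗ[ℂ] (L q).val f := fun f =>
    LinearMap.proj f ∘ₗ T ∘ₗ LinearMap.single ℂ (fun f : Coloring ℓ d => (L p).val f) f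
  have hη : ∀ f (v : (L p).val f), T (Pi.single f v) = Pi.single f (η f v) := fun f v =>
    eq_single_of_mem_weightSpace (L q) (hmem f v)
  refine L_eq_of_natural p q η (fun {f g} π v => ?_) ?_
  · apply Pi.single_injective (M := fun f : Coloring ℓ d => (L q).val f) g
    rw [← hη, ← wreathRep_inr_single, ← wreathRep_inr_single, hT, hη]
  · have := nontrivial_L_val p
    obtain ⟨v, hv⟩ := exists_ne (0 : (L p).val (canon p.1))
    refine ⟨canon p.1, fun h => hv ?_⟩
    have h1 := hη _ v
    rw [h, LinearMap.zero_apply, Pi.single_zero] at h1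
    have h2 := e.toLinearEquiv.injective (h1.trans (map_zero e.toLinearEquiv).symm)
    rwa [Pi.single_eq_zero_iff] at h2

/-- The finite orbit of any nonzero vector spans. Irreducible representations of the wreath product
are not assumed finite dimensional, while the character argument needs this. -/
theorem finiteDimensional_of_isIrreducible {G : Type*} [Group G] [Finite G]
    (ρ : Representation ℂ G V) [ρ.IsIrreducible] [Nontrivial V] : FiniteDimensional ℂ V := by
  obtain ⟨v, hv⟩ := exists_ne (0 : V)
  have htop : Submodule.span ℂ (Set.range fun g => ρ g v) = ⊤ := by
    refine eq_top_of_isIrreducible ρ _ (fun g u hu => ?_) fun h => hv ?_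
    · have hle : Submodule.span ℂ (Set.range fun g => ρ g v) ≤
          (Submodule.span ℂ (Set.range fun g => ρ g v)).comap (ρ g) := by
        rw [Submodule.span_le]
        rintro _ ⟨k, rfl⟩
        refine Submodule.subset_span ⟨g * k, ?_⟩
        simp only [map_mul, Module.End.mul_apply]
      exact hle hu
    · rw [Submodule.span_eq_bot] at h
      simpa using h _ ⟨1, rfl⟩
  exact ⟨htop ▸ Submodule.fg_span (Set.finite_range _)⟩

/-- A natural family of maps to the weight spaces assembles to an intertwining map. -/
def wreathHom {M : GMod ℓ d} (η : ∀ f : Coloring ℓ d, M.val f →ₗ[ℂ] weightSpace ρ f)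
    (hη : ∀ {f g : Coloring ℓ d} (π : f ⟶ g) (v : M.val f),
      η g (M.act π v) = weightSpaceMap ρ π (η f v)) : (wreathRep M).IntertwiningMap ρ :=
  (∑ f, (weightSpace ρ f).subtype ∘ₗ η f ∘ₗ
      LinearMap.proj f : (∀ f, M.val f) →ₗ[ℂ] V).intertwiningMap_of_isIntertwiningMap _ _ <| by
    intro w v
    simp only [LinearMap.sum_apply, LinearMap.comp_apply, LinearMap.proj_apply, map_sum]
    -- The component at `f` of the transformed vector comes from the component of `v` at `pull
    -- w.right f`, so the summands are matched along `pull`.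
    refine Fintype.sum_equiv
      (Equiv.ofBijective _ (Finite.injective_iff_bijective.1 (pull_injective w.right))) _ _
      fun f => ?_
    rw [wreathRep_apply, map_smul, hη, map_smul]
    have hw := SemidirectProduct.inl_left_mul_inr_right w
    conv_rhs => rw [← hw, map_mul, Module.End.mul_apply]
    exact (map_mem_weightSpace ρ (pullHom w.right f) (η _ (v _)).2 w.left).symm

theorem wreathHom_single {M : GMod ℓ d} (η : ∀ f : Coloring ℓ d, M.val f →ₗ[ℂ] weightSpace ρ f)
    (hη : ∀ {f g : Coloring ℓ d} (π : f ⟶ g) (v : M.val f),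
      η g (M.act π v) = weightSpaceMap ρ π (η f v)) (f : Coloring ℓ d) (v : M.val f) :
    wreathHom ρ η hη (Pi.single f v) = η f v := by
  change (∑ g, (weightSpace ρ g).subtype ∘ₗ η g ∘ₗ
      LinearMap.proj g : (∀ f, M.val f) →ₗ[ℂ] V) (Pi.single f v) = _
  simp only [LinearMap.sum_apply, LinearMap.comp_apply, LinearMap.proj_apply]
  rw [Finset.sum_eq_single f]
  · rw [Pi.single_eq_same]
    rfl
  · intro g _ hg
    rw [Pi.single_eq_of_ne hg, map_zero, map_zero]
  · simp

/-- The weight spaces form a nonzero groupoid action and so receive a nonzero family of maps from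
some `L p`. Assembled, these intertwine two irreducible representations, and Schur's lemma applies.
-/
theorem exists_equiv_wreathRep_L [NeZero ℓ] [ρ.IsIrreducible] :
    ∃ p : MultiPartition ℓ d, Nonempty (ρ.Equiv (wreathRep (L p))) := by
  have : Finite (Wreath ℓ d) := Finite.of_equiv _ SemidirectProduct.equivProd.symm
  have := nontrivial_of_isIrreducible ρ
  have := finiteDimensional_of_isIrreducible ρ
  obtain ⟨p, η, hη, f, hf⟩ := exists_natural_from_L (V := fun f => weightSpace ρ f)
    (weightSpaceMap ρ)
    (fun f v => Subtype.ext (by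
      change ρ (SemidirectProduct.inr 1) v.1 = v.1
      rw [map_one, map_one]
      rfl))
    (fun π σ v => Subtype.ext (by
      change ρ (SemidirectProduct.inr (σ.1 * π.1)) v.1 =
        ρ (SemidirectProduct.inr σ.1) (ρ (SemidirectProduct.inr π.1) v.1)
      rw [map_mul, map_mul]
      rfl))
    (exists_weightSpace_nontrivial ρ)
  have := wreathRep_L_isIrreducible p
  refine ⟨p, ⟨((wreathHom ρ η hη).ofBijective
    ((Representation.IsIrreducible.bijective_or_eq_zero _).resolve_right fun h => hf ?_)).symm⟩⟩
  refine LinearMap.ext fun v => Subtype.ext ?_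
  rw [← wreathHom_single ρ η hη, h]
  rfl

end Wreath

end

end GenSym

theorem proposition2p9 (ℓ d : ℕ) (hℓ : 0 < ℓ) :
    -- `L_p` is the Specht module of `p` on colorings of the type of `p`, and zero elsewhere
    (∀ p : GenSym.MultiPartition ℓ d,
      (∃ θ : ∀ f : GenSym.Coloring ℓ d, GenSym.type f = p.1 →
          (GenSym.MultiSpecht p.2 ≃ₗ[ℂ] (GenSym.L p).val f),
        ∀ (f g : GenSym.Coloring ℓ d) (hf : GenSym.type f = p.1) (hg : GenSym.type g = p.1)
          (π : f ⟶ g) (v : GenSym.MultiSpecht p.2),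
          (GenSym.L p).act π (θ f hf v) =
            θ g hg (GenSym.multiSpechtRep p.2 (GenSym.toYoung hf hg π) v)) ∧
      ∀ f : GenSym.Coloring ℓ d, GenSym.type f ≠ p.1 → Subsingleton ((GenSym.L p).val f)) ∧
    -- every `L_p` is a simple module over the linearized groupoid
    (∀ p : GenSym.MultiPartition ℓ d, Simple (GenSym.L p)) ∧
    -- the `L_p` are pairwise non-isomorphic
    (∀ p q : GenSym.MultiPartition ℓ d, Nonempty (GenSym.L p ≅ GenSym.L q) → p = q) ∧
    -- every simple module is isomorphic to some `L_p`
    (∀ M : GenSym.GMod ℓ d, Simple M →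
      ∃ p : GenSym.MultiPartition ℓ d, Nonempty (M ≅ GenSym.L p)) ∧
    -- the corresponding representations of the generalized symmetric group are irreducible
    (∀ p : GenSym.MultiPartition ℓ d, (GenSym.wreathRep (GenSym.L p)).IsIrreducible) ∧
    -- they are pairwise non-isomorphic
    (∀ p q : GenSym.MultiPartition ℓ d,
      Nonempty ((GenSym.wreathRep (GenSym.L p)).Equiv (GenSym.wreathRep (GenSym.L q))) → p = q) ∧
    -- every irreducible representation is isomorphic to one of them
    (∀ (V : Type*) [AddCommGroup V] [Module ℂ V]
      (ρ : Representation ℂ (GenSym.Wreath ℓ d) V), ρ.IsIrreducible →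
      ∃ p : GenSym.MultiPartition ℓ d,
        Nonempty (ρ.Equiv (GenSym.wreathRep (GenSym.L p)))) := by
  have : NeZero ℓ := ⟨hℓ.ne'⟩
  exact ⟨fun p => ⟨⟨fun _ hf => GenSym.LEquiv p hf, fun _ _ hf hg π v =>
      GenSym.L_act_LEquiv p hf hg π v⟩, fun _ hf => GenSym.L_subsingleton p hf⟩,
    GenSym.L_simple, fun p q h => GenSym.eq_of_L_iso p q h.some,
    fun M _ => GenSym.exists_iso_L M, GenSym.wreathRep_L_isIrreducible,
    fun p q h => GenSym.eq_of_wreathRep_L_equiv p q h.some,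
    fun V _ _ ρ _ => GenSym.exists_equiv_wreathRep_L ρ⟩
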